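/- Let $k$ be an algebraically closed field of characteristic $0$, and let $n \ge 2$ and $d \ge \min\{n,3\}$ be integers. Let $\mathrm{End}^n_d$ be the parameter space of degree-$d$ endomorphisms of $\mathbb{P}^n$ over $k$, that is, the set of points $f = (f_0 : \cdots : f_n)$ of the projective space of $(n+1)$-tuples of degree-$d$ forms in $n+1$ variables such that $f_0, \ldots, f_n$ have no common zero in $\mathbb{P}^n$, with the induced Zariski topology. For $f \in \mathrm{End}^n_d$ let $C_f \subset \mathbb{P}^n$ be its critical locus, the vanishing locus of the Jacobian determinant $\det(\partial f_i/\partial x_j)_{0 \le i,j \le n}$. A hypersurface $H \subset \mathbb{P}^n$ is called improper under a nonconstant endomorphism $g$ of $\mathbb{P}^n$ if for every irreducible component $Z$ of $H$ there exist integers $0 \le i_0 < i_1 < \cdots < i_n$ such that $g^{i_0}(Z) \cap \cdots \cap g^{i_n}(Z) \neq \varnothing$, where $g^i$ denotes the $i$-th iterate; $H$ is called dynamically improper under $f$ if $H$ is improper under $f^r$ for every integer $r > 0$; and $f$ is called post-critically dynamically improper if $C_f$ is dynamically improper under $f$. Then the set \[ \{ f \in \mathrm{End}^n_d : f \text{ is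 post-critically dynamically improper} \} \] is Zariski dense in $\mathrm{End}^n_d$. -/

import Mathlib

open scoped LinearAlgebra.Projectivization

namespace DynImproper

/-- The set of points of the projective space `ℙ(k^ι)` at which all the forms in `S` vanish.
For homogeneous polynomials this does not depend on the representative `p.rep` of `p`. -/
def zeroLocus {k : Type*} [Field k] {ι : Type*} (S : Set (MvPolynomial ι k)) :
    Set (ℙ k (ι → k)) :=
  {p | ∀ F ∈ S, MvPolynomial.eval p.rep F = 0}

/-- A set of homogeneous polynomials (of possibly different degrees). -/
def IsHomogeneousSet {k : Type*} [Field k] {ι : Type*} (S : Set (MvPolynomial ι k)) : Prop :=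
  ∀ F ∈ S, ∃ m : ℕ, F.IsHomogeneous m

/-- The Zariski topology on the projective space `ℙ(k^ι)`: the closed sets are the common zero
loci of sets of homogeneous polynomials. -/
instance zariskiTopology {k : Type*} [Field k] {ι : Type*} : TopologicalSpace (ℙ k (ι → k)) :=
  TopologicalSpace.ofClosed
    {Z | ∃ S : Set (MvPolynomial ι k), IsHomogeneousSet S ∧ Z = zeroLocus S}
    (by
      refine ⟨{1}, ?_, ?_⟩
      · rintro F rfl
        exact ⟨0, MvPolynomial.isHomogeneous_one _ _⟩
      · ext p
        simp [zeroLocus])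
    (by
      intro A hA
      refine ⟨{F | ∃ Z ∈ A, ∃ S : Set (MvPolynomial ι k),
        IsHomogeneousSet S ∧ Z = zeroLocus S ∧ F ∈ S}, ?_, ?_⟩
      · rintro F ⟨Z, -, S, hS, -, hF⟩
        exact hS F hF
      · ext p
        constructor
        · rintro hp F ⟨Z, hZ, S, -, rfl, hF⟩
          exact hp _ hZ F hF
        · intro hp Z hZ
          obtain ⟨S, hS, rfl⟩ := hA hZ
          intro F hF
          exact hp F ⟨_, hZ, S, hS, rfl, hF⟩)
    (by
      rintro _ ⟨S, hS, rfl⟩ _ ⟨T, hT, rfl⟩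
      refine ⟨{F | ∃ G ∈ S, ∃ H ∈ T, F = G * H}, ?_, ?_⟩
      · rintro F ⟨G, hG, H, hH, rfl⟩
        obtain ⟨a, ha⟩ := hS G hG
        obtain ⟨b, hb⟩ := hT H hH
        exact ⟨a + b, ha.mul hb⟩
      · ext p
        constructor
        · rintro (hp | hp) F ⟨G, hG, H, hH, rfl⟩
          · rw [map_mul, hp G hG, zero_mul]
          · rw [map_mul, hp H hH, mul_zero]
        · intro hp
          by_contra hcon
          simp only [Set.mem_union, not_or, zeroLocus, Set.mem_ofPred_eq, not_forall] at hcon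
          obtain ⟨⟨G, hG, hGp⟩, H, hH, hHp⟩ := hcon
          have h := hp (G * H) ⟨G, hG, H, hH, rfl⟩
          rw [map_mul] at h
          exact (mul_ne_zero hGp hHp) h)

/-- Projective `n`-space over `k`. -/
abbrev PSpace (k : Type*) [Field k] (n : ℕ) : Type _ := ℙ k (Fin (n + 1) → k)

/-- The index set of the coefficients of an `(n+1)`-tuple of degree-`d` forms in `n+1` variables:
pairs `(i, α)` with `0 ≤ i ≤ n` and `α` the exponent vector of a monomial of degree `d`. -/
abbrev CoeffIndex (n d : ℕ) : Type :=
  Fin (n + 1) × ↥(Finset.finsuppAntidiag (Finset.univ : Finset (Fin (n + 1))) d)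

/-- The `i`-th form of the `(n+1)`-tuple of degree-`d` forms with coefficient vector `c`. -/
noncomputable def form {k : Type*} [Field k] {n d : ℕ} (c : CoeffIndex n d → k)
    (i : Fin (n + 1)) : MvPolynomial (Fin (n + 1)) k :=
  ∑ α : ↥(Finset.finsuppAntidiag (Finset.univ : Finset (Fin (n + 1))) d),
    MvPolynomial.monomial (α : Fin (n + 1) →₀ ℕ) (c (i, α))

/-- The projective space of `(n+1)`-tuples of degree-`d` forms in `n+1` variables. -/
abbrev EndBar (k : Type*) [Field k] (n d : ℕ) : Type _ := ℙ k (CoeffIndex n d → k)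

/-- `(f_0 : … : f_n)` is a morphism of degree `d`: the forms have no common zero in `ℙⁿ`. -/
def IsMorphism {k : Type*} [Field k] {n d : ℕ} (f : EndBar k n d) : Prop :=
  ∀ v : Fin (n + 1) → k, v ≠ 0 → ∃ i, MvPolynomial.eval v (form f.rep i) ≠ 0

/-- The parameter space of degree-`d` endomorphisms of `ℙⁿ`, with the topology induced from
the Zariski topology of the projective space of tuples of forms. -/
abbrev EndSpace (k : Type*) [Field k] (n d : ℕ) : Type _ := {f : EndBar k n d // IsMorphism f}

/-- The self-map `p ↦ (f_0(p) : … : f_n(p))` of `ℙⁿ`. By homogeneity it does not depend on the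
representatives chosen for `p` and for `f`. -/
noncomputable def toMap {k : Type*} [Field k] {n d : ℕ} (f : EndSpace k n d) :
    PSpace k n → PSpace k n := fun p =>
  Projectivization.mk k (fun i => MvPolynomial.eval p.rep (form f.1.rep i)) (fun h => by
    obtain ⟨i, hi⟩ := f.2 p.rep p.rep_nonzero
    exact hi (congrFun h i))

/-- The Jacobian determinant `det (∂f_i/∂x_j)` of the tuple of forms with coefficients `c`. -/
noncomputable def jacobian {k : Type*} [Field k] {n d : ℕ} (c : CoeffIndex n d → k) :
    MvPolynomial (Fin (n + 1)) k :=
  Matrix.det (Matrix.of fun i j : Fin (n + 1) => MvPolynomial.pderiv j (form c i))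

/-- The critical locus `C_f = V(J_f)` of an endomorphism `f` of `ℙⁿ`. -/
noncomputable def criticalLocus {k : Type*} [Field k] {n d : ℕ} (f : EndSpace k n d) :
    Set (PSpace k n) :=
  zeroLocus {jacobian f.1.rep}

/-- `H` is improper under the self-map `f` of `ℙⁿ`: for every irreducible component `Z` of `H`
there are `0 ≤ i_0 < … < i_n` such that `f^{i_0}(Z) ∩ … ∩ f^{i_n}(Z)` is non-empty. -/
def IsImproper {k : Type*} [Field k] {n : ℕ} (f : PSpace k n → PSpace k n)
    (H : Set (PSpace k n)) : Prop :=
  ∀ W ∈ irreducibleComponents ↥H, ∃ i : Fin (n + 1) → ℕ, StrictMono i ∧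
    (⋂ j : Fin (n + 1), f^[i j] '' ((Subtype.val : ↥H → PSpace k n) '' W)).Nonempty

/-- `H` is dynamically improper under `f`: it is improper under every iterate `f^r`, `r > 0`. -/
def IsDynamicallyImproper {k : Type*} [Field k] {n : ℕ} (f : PSpace k n → PSpace k n)
    (H : Set (PSpace k n)) : Prop :=
  ∀ r : ℕ, 0 < r → IsImproper (f^[r]) H

/-- `f` is post-critically dynamically improper: its critical locus is dynamically improper. -/
def IsPostCriticallyDynamicallyImproper {k : Type*} [Field k] {n d : ℕ} (f : EndSpace k n d) :
    Prop :=
  IsDynamicallyImproper (toMap f) (criticalLocus f)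

end DynImproper

/-! If the critical locus is irreducible and contains a periodic point `p` of `f`, then `p` lies in
infinitely many images of it under the iterates of any `f^r`, so impropriety is automatic
(`isDynamicallyImproper_of_periodic`). It therefore suffices to find, in every nonempty open set of
endomorphisms, one with irreducible Jacobian determinant and a periodic critical point.

Being a morphism and having irreducible Jacobian both hold wherever a suitable nonzero polynomial in
the coefficients does not vanish. The first is elimination theory
(`exists_forall_eval_ne_zero_of_no_common_zero`); the second follows from it by viewing
factorizations as rank-one tensors (`exists_forall_irreducible`), starting from an explicit tuple
treated by Eisenstein's criterion (`pencilJacobian_irreducible`).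

It remains to see that no nonzero polynomial `P` in the coefficients vanishes on all tuples with a
periodic critical point (`exists_periodic_critical_point`). Join a tuple where `P ≠ 0` to the skew
tuples `(x₀ᵈ, x₁ᵈ, xᵢ (x₁ - t x₀) x₀ᵈ⁻²)` by a parameter `s`, with `s = 0` the skew ones. An affine
cycle of length `M + 1` with critical first point, together with `(t, s)`, is a solution of a system
with one more unknown than equations, so by Krull's height theorem no solution is isolated. For `t =
ζ` with `ζ ^ (d ^ (M + 1) - 1) = 1`, the line `x₂ = ⋯ = 0` carries a solution with `s = 0` that is
isolated inside `s = 0` (`cycle_isolated`). Hence there are solutions with `s ≠ 0`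
(`exists_zero_of_isolated`). For large `M` some `ζ` avoids the zeros of the leading part of `P`
along `s = 0`, and then `P ≠ 0` can be kept. -/

open MvPolynomial

/-! ### Homogeneous factors and elimination -/

/-- A factor of a nonzero homogeneous polynomial over a domain is homogeneous. -/
theorem MvPolynomial.IsHomogeneous.of_mul_left {σ k : Type*} [CommRing k] [IsDomain k]
    {A B : MvPolynomial σ k} {D : ℕ} (hAB : (A * B).IsHomogeneous D) (h0 : A * B ≠ 0) :
    A.IsHomogeneous A.totalDegree := by
  have hA : A ≠ 0 := left_ne_zero_of_mul h0
  have hB : B ≠ 0 := right_ne_zero_of_mul h0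
  have htot : A.totalDegree + B.totalDegree = D := by
    rw [← totalDegree_mul_of_isDomain hA hB, hAB.totalDegree h0]
  -- Lowest degrees add under multiplication just as top degrees do. Both sums are `D`, which forces
  -- order and total degree to agree in each factor.
  have hord : (D : ℕ∞) ≤ (A : MvPowerSeries σ k).order + (B : MvPowerSeries σ k).order := by
    rw [← MvPowerSeries.order_mul]
    refine MvPowerSeries.nat_le_order fun e he => ?_
    rw [← coe_mul, coeff_coe]
    exact hAB.coeff_eq_zero he.ne
  have hle : ∀ {C : MvPolynomial σ k} {e : σ →₀ ℕ}, coeff e C ≠ 0 → e.degree ≤ C.totalDegree := by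
    intro C e he
    exact le_totalDegree (mem_support_iff.2 he)
  obtain ⟨b, hb⟩ := MvPolynomial.ne_zero_iff.1 hB
  have hbo : (B : MvPowerSeries σ k).order ≤ (B.totalDegree : ℕ∞) :=
    (MvPowerSeries.order_le (d := b) (by rwa [coeff_coe])).trans (by exact_mod_cast hle hb)
  intro e he
  rw [show Finsupp.weight (1 : σ → ℕ) e = e.degree by
    rw [Finsupp.degree_eq_weight_one]; rfl]
  refine le_antisymm (hle he) ?_
  have hao : (A : MvPowerSeries σ k).order ≤ (e.degree : ℕ∞) :=
    MvPowerSeries.order_le (by rwa [coeff_coe])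
  have : (D : ℕ∞) ≤ ((e.degree + B.totalDegree : ℕ) : ℕ∞) := by
    push_cast
    exact hord.trans (add_le_add hao hbo)
  have := Nat.cast_le.1 this
  omega

/-- **Openness of the absence of common zeros.** If a family of forms depending polynomially on
a parameter has no common nontrivial zero at the parameter `c₀`, then the same holds wherever a
certain polynomial in the parameter, nonvanishing at `c₀`, does not vanish. -/
theorem MvPolynomial.exists_forall_eval_ne_zero_of_no_common_zero
    {k σ ι J : Type*} [Field k] [IsAlgClosed k] [Finite ι]
    (G : J → MvPolynomial ι (MvPolynomial σ k)) (e : J → ℕ)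
    (hG : ∀ j, (G j).IsHomogeneous (e j)) (c₀ : σ → k)
    (h₀ : ∀ x : ι → k, x ≠ 0 → ∃ j, eval x (map (eval c₀) (G j)) ≠ 0) :
    ∃ P : MvPolynomial σ k, eval c₀ P ≠ 0 ∧
      ∀ c, eval c P ≠ 0 → ∀ x : ι → k, x ≠ 0 → ∃ j, eval x (map (eval c) (G j)) ≠ 0 := by
  classical
  set I : Ideal (MvPolynomial ι (MvPolynomial σ k)) := Ideal.span (Set.range G) with hI
  set φ : MvPolynomial ι (MvPolynomial σ k) →+* MvPolynomial ι k := map (eval c₀) with hφ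
  have hsurj : Function.Surjective φ :=
    map_surjective _ fun a => ⟨C a, by simp⟩
  -- Nullstellensatz: at `c₀` the forms vanish together at most at the origin.
  have hrad : idealOfVars ι k ≤ (I.map φ).radical := by
    rw [idealOfVars, Ideal.span_le]
    rintro _ ⟨i, rfl⟩
    rw [← vanishingIdeal_zeroLocus_eq_radical (K := k)]
    intro x hx
    by_contra hne
    have hx0 : x ≠ 0 := by
      rintro rfl
      simp at hne
    obtain ⟨j, hj⟩ := h₀ x hx0
    refine hj ?_
    have := hx (φ (G j)) (Ideal.mem_map_of_mem _ (Ideal.subset_span ⟨j, rfl⟩))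
    simpa [aeval_def] using this
  obtain ⟨N, hN⟩ := Ideal.exists_pow_le_of_le_radical_of_fg hrad (idealOfVars_fg ι k)
  let _ := gradedAlgebra (σ := ι) (R := MvPolynomial σ k)
  have hIhom : I.IsHomogeneous (homogeneousSubmodule ι (MvPolynomial σ k)) := by
    refine Ideal.homogeneous_span _ _ ?_
    rintro _ ⟨j, rfl⟩
    exact ⟨e j, hG j⟩
  set m : Ideal (MvPolynomial σ k) := RingHom.ker (eval c₀) with hm
  -- Every form of degree `N` lies in `I` modulo `m`: lift its specialization at `c₀` to `I` and
  -- keep only the degree `N` component, which stays in the homogeneous ideal `I`.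
  have hkey : homogeneousSubmodule ι (MvPolynomial σ k) N ≤
      I.restrictScalars (MvPolynomial σ k) ⊔ m • homogeneousSubmodule ι (MvPolynomial σ k) N := by
    intro p hp
    have hp' : p.IsHomogeneous N := hp
    have hφp : φ p ∈ I.map φ := by
      refine hN ?_
      rw [mem_pow_idealOfVars_iff']
      intro x hx
      exact (hp'.map (eval c₀)).coeff_eq_zero hx.ne
    obtain ⟨q, hq, hqp⟩ := (Ideal.mem_map_iff_of_surjective φ hsurj).1 hφp
    set q' := homogeneousComponent N q with hq'
    have hq'I : q' ∈ I := homogeneousComponent_mem_of_mem hIhom hq N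
    have hq'hom : q'.IsHomogeneous N := homogeneousComponent_isHomogeneous _ _
    have hcoef : ∀ d, coeff d (p - q') ∈ m := by
      intro d
      rw [hm, RingHom.mem_ker, coeff_sub, hq', coeff_homogeneousComponent]
      by_cases hd : d.degree = N
      · rw [if_pos hd, map_sub]
        have := congrArg (coeff d) hqp
        rw [hφ, coeff_map, coeff_map] at this
        rw [this, sub_self]
      · rw [if_neg hd, hp'.coeff_eq_zero hd]
        simp
    have hmem : p - q' ∈ m • homogeneousSubmodule ι (MvPolynomial σ k) N := by
      rw [(p - q').as_sum]
      refine Submodule.sum_mem _ fun d hd => ?_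
      have : monomial d (coeff d (p - q')) = coeff d (p - q') •
          (monomial d (1 : MvPolynomial σ k)) := by
        rw [smul_monomial, smul_eq_mul, mul_one]
      rw [this]
      refine Submodule.smul_mem_smul (hcoef d) ?_
      refine isHomogeneous_monomial _ ?_
      by_contra hne
      exact (mem_support_iff.1 hd) ((hp'.sub hq'hom).coeff_eq_zero hne)
    have : p = q' + (p - q') := by ring
    rw [this]
    exact Submodule.add_mem_sup hq'I hmem
  -- Nakayama for the finitely generated module of degree `N` forms. The resulting `r` takes the
  -- value `1` at `c₀` and satisfies `r * xᵢ ^ N ∈ I` for all `i`, so a common zero at a parameter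
  -- with `r ≠ 0` is the origin.
  obtain ⟨r, hr1, hr⟩ := Submodule.exists_sub_one_mem_and_smul_le_of_fg_of_le_sup
    (homogeneousSubmodule_fg ι (MvPolynomial σ k) N) le_rfl hkey
  refine ⟨r, ?_, fun c hc x hx => ?_⟩
  · have : eval c₀ r = 1 := by
      rw [hm, RingHom.mem_ker, map_sub, map_one, sub_eq_zero] at hr1
      exact hr1
    simp [this]
  · by_contra! hcon
    apply hx
    funext i
    have hmem : r • (X i : MvPolynomial ι (MvPolynomial σ k)) ^ N ∈ I := by
      refine hr (Submodule.smul_mem_pointwise_smul _ r _ ?_)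
      exact isHomogeneous_X_pow i N
    have hle : I ≤ RingHom.ker ((eval x).comp (map (eval c))) := by
      rw [hI, Ideal.span_le]
      rintro _ ⟨j, rfl⟩
      exact hcon j
    have := hle hmem
    rw [RingHom.mem_ker, smul_eq_C_mul] at this
    simp only [map_mul, map_pow, RingHom.comp_apply, map_C, map_X, eval_C, eval_X] at this
    exact eq_zero_of_pow_eq_zero ((mul_eq_zero.1 this).resolve_left hc)

/-! ### Krull's height theorem and isolated zeros -/

/-- The ideal of a rational point of affine `τ`-space has height at least `|τ|`. -/
theorem MvPolynomial.card_le_height_ker_eval {k τ : Type*} [Field k] [Fintype τ] (z : τ → k) :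
    (Fintype.card τ : ℕ∞) ≤ (RingHom.ker (eval z)).height := by
  classical
  -- Evaluating only the variables in `S` gives prime kernels that increase strictly with `S`: a
  -- chain of length `|τ|`.
  let φ : Finset τ → MvPolynomial τ k →ₐ[k] MvPolynomial τ k :=
    fun S => aeval fun v => if v ∈ S then C (z v) else X v
  have hφ : ∀ S v, φ S (X v) = if v ∈ S then C (z v) else X v := fun S v => by
    simp [φ]
  have hstep : ∀ S v, v ∉ S → RingHom.ker (φ S) < RingHom.ker (φ (insert v S)) := by
    intro S v hv
    refine lt_of_le_of_ne ?_ ?_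
    · intro f hf
      have hcomp : (φ (insert v S)) = (φ {v}).comp (φ S) := by
        refine algHom_ext fun w => ?_
        simp only [AlgHom.comp_apply, hφ, Finset.mem_insert]
        by_cases hw : w ∈ S
        · simp [hw, algHom_C]
        · simp [hw, hφ]
      rw [RingHom.mem_ker] at hf ⊢
      rw [hcomp, AlgHom.comp_apply, hf, map_zero]
    · intro heq
      have h1 : X v - C (z v) ∈ RingHom.ker (φ (insert v S)) := by
        rw [RingHom.mem_ker, map_sub, hφ, if_pos (Finset.mem_insert_self _ _), algHom_C,
          algebraMap_eq, sub_self]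
      rw [← heq, RingHom.mem_ker, map_sub, hφ, if_neg hv, algHom_C, algebraMap_eq,
        sub_eq_zero] at h1
      have := congrArg totalDegree h1
      simp at this
  have hheight : ∀ S : Finset τ, (S.card : ℕ∞) ≤ (RingHom.ker (φ S)).height := by
    intro S
    induction S using Finset.induction_on with
    | empty => simp
    | insert v S hv ih =>
      have : (RingHom.ker (φ S)).IsPrime := RingHom.ker_isPrime _
      have : (RingHom.ker (φ (insert v S))).IsPrime := RingHom.ker_isPrime _
      rw [Finset.card_insert_of_notMem hv]
      push_cast
      exact (add_le_add_left ih 1).trans (Ideal.height_add_one_le_of_lt_of_isPrime (hstep S v hv))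
  have hker : RingHom.ker (φ Finset.univ) = RingHom.ker (eval z) := by
    have : ∀ f, φ Finset.univ f = C (eval z f) := by
      intro f
      have : φ Finset.univ = (Algebra.ofId k _).comp (aeval z) :=
        algHom_ext fun w => by simp [hφ, Algebra.ofId_apply]
      rw [this]
      simp [Algebra.ofId_apply, algebraMap_eq]
    ext f
    rw [RingHom.mem_ker, RingHom.mem_ker, this, map_eq_zero_iff _ (C_injective _ _)]
  rw [← hker]
  exact hheight Finset.univ

/-- Fewer equations than unknowns: if `z` is a zero of the `E j` that is isolated inside the
hypersurface `s = 0`, and `Q z ≠ 0`, then the `E j` have a zero at which neither `s` nor `Q`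
vanishes. -/
theorem MvPolynomial.exists_zero_of_isolated {k τ κ : Type*} [Field k] [IsAlgClosed k]
    [Fintype τ] [Fintype κ] (hcard : Fintype.card κ < Fintype.card τ)
    (E : κ → MvPolynomial τ k) (s Q : MvPolynomial τ k) (z : τ → k)
    (hE : ∀ j, eval z (E j) = 0) (hQ : eval z Q ≠ 0)
    (hz : ∀ q : Ideal (MvPolynomial τ k), q.IsPrime → q ≤ RingHom.ker (eval z) →
      (∀ j, E j ∈ q) → s ∈ q → ∀ v, X v - C (z v) ∈ q) :
    ∃ w : τ → k, (∀ j, eval w (E j) = 0) ∧ eval w s ≠ 0 ∧ eval w Q ≠ 0 := by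
  classical
  by_contra! hcon
  -- If the conclusion fails, `s * Q` vanishes on the whole zero set of the `E j`.
  have hrad : s * Q ∈ (Ideal.span (Set.range E)).radical := by
    rw [← vanishingIdeal_zeroLocus_eq_radical (K := k)]
    intro x hx
    have hx' : ∀ j, eval x (E j) = 0 := fun j => by
      have := hx (E j) (Ideal.subset_span ⟨j, rfl⟩)
      simpa [aeval_def] using this
    rw [map_mul]
    by_cases hs : eval x s = 0
    · simp [aeval_def, hs]
    · have := hcon x hx' hs
      simp [aeval_def, this]
  -- A prime `q` containing the `E j` and vanishing at `z` contains `s * Q`, hence `s`, so isolation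
  -- forces it to be the ideal of `z`. That ideal is then minimal over too few equations for its
  -- height.
  have hmin : RingHom.ker (eval z) ∈ (Ideal.span (Set.range E)).minimalPrimes := by
    refine ⟨⟨RingHom.ker_isPrime _, ?_⟩, ?_⟩
    · rw [Ideal.span_le]
      rintro _ ⟨j, rfl⟩
      exact hE j
    · rintro q ⟨hq, hEq⟩ hle
      have hEq' : ∀ j, E j ∈ q := fun j => hEq (Ideal.subset_span ⟨j, rfl⟩)
      have hsQ : s * Q ∈ q := (hq.radical_le_iff.2 hEq) hrad
      have hs : s ∈ q := (hq.mem_or_mem hsQ).resolve_right fun h => hQ (hle h)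
      have hv := hz q hq hle hEq' hs
      intro f hf
      have hmap : (Ideal.Quotient.mkₐ k q) = (Algebra.ofId k _).comp (aeval z) := by
        refine algHom_ext fun v => ?_
        have := (Ideal.Quotient.mk_eq_mk_iff_sub_mem (X v) (C (z v))).2 (hv v)
        rw [AlgHom.comp_apply, aeval_X]
        exact this
      have h1 := DFunLike.congr_fun hmap f
      have h2 : aeval z f = 0 := by simpa [aeval_def] using hf
      rw [AlgHom.comp_apply, h2, map_zero] at h1
      exact Ideal.Quotient.eq_zero_iff_mem.1 h1
  have h1 := Ideal.height_le_card_of_mem_minimalPrimes_span (Set.finite_range E) hmin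
  have h2 := (card_le_height_ker_eval z).trans h1
  have h3 : (Set.range E).ncard ≤ Fintype.card κ := by
    rw [← Set.image_univ, ← Nat.card_eq_fintype_card, ← Set.ncard_univ]
    exact Set.ncard_image_le
  have := Nat.cast_le.1 h2
  omega

/-! ### Openness of irreducibility -/

/-- Monomials of degree `a` in the variables `ι`. -/
abbrev MonomialsOfDegree (ι : Type*) [Fintype ι] [DecidableEq ι] (a : ℕ) : Type _ :=
  ↥(Finset.finsuppAntidiag (Finset.univ : Finset ι) a)

/-- The form of degree `a` with coefficient vector `u`. -/
noncomputable def formOfCoeffs {ι R : Type*} [Fintype ι] [DecidableEq ι] [CommSemiring R] {a : ℕ}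
    (u : MonomialsOfDegree ι a → R) : MvPolynomial ι R :=
  ∑ α : MonomialsOfDegree ι a, monomial (α : ι →₀ ℕ) (u α)

section FormOfCoeffs

variable {ι R : Type*} [Fintype ι] [DecidableEq ι] [CommSemiring R] {a b : ℕ}

theorem degree_monomialsOfDegree (α : MonomialsOfDegree ι a) : (α : ι →₀ ℕ).degree = a := by
  have := (Finset.mem_finsuppAntidiag.1 α.2).1
  rwa [Finsupp.degree_eq_sum]

theorem formOfCoeffs_isHomogeneous (u : MonomialsOfDegree ι a → R) :
    (formOfCoeffs u).IsHomogeneous a :=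
  IsHomogeneous.sum _ _ _ fun α _ => isHomogeneous_monomial _ (degree_monomialsOfDegree α)

theorem coeff_formOfCoeffs (u : MonomialsOfDegree ι a → R) (α : MonomialsOfDegree ι a) :
    coeff (α : ι →₀ ℕ) (formOfCoeffs u) = u α := by
  rw [formOfCoeffs, coeff_sum, Finset.sum_eq_single α]
  · simp
  · intro β _ hβ
    rw [coeff_monomial, if_neg fun h => hβ (Subtype.ext h)]
  · simp

theorem formOfCoeffs_coeff {F : MvPolynomial ι R} (hF : F.IsHomogeneous a) :
    formOfCoeffs (fun α : MonomialsOfDegree ι a => coeff (α : ι →₀ ℕ) F) = F := by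
  ext e
  by_cases he : e.degree = a
  · exact coeff_formOfCoeffs (fun α : MonomialsOfDegree ι a => coeff (α : ι →₀ ℕ) F)
      ⟨e, Finset.mem_finsuppAntidiag.2 ⟨by rwa [← Finsupp.degree_eq_sum], Finset.subset_univ _⟩⟩
  · rw [(formOfCoeffs_isHomogeneous _).coeff_eq_zero he, hF.coeff_eq_zero he]

theorem coeff_formOfCoeffs_mul (u : MonomialsOfDegree ι a → R) (v : MonomialsOfDegree ι b → R)
    (γ : ι →₀ ℕ) :
    coeff γ (formOfCoeffs u * formOfCoeffs v) =
      ∑ p : MonomialsOfDegree ι a × MonomialsOfDegree ι b,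
        if (p.1 : ι →₀ ℕ) + (p.2 : ι →₀ ℕ) = γ then u p.1 * v p.2 else 0 := by
  rw [formOfCoeffs, formOfCoeffs, Finset.sum_mul_sum, ← Finset.univ_product_univ,
    Finset.sum_product, coeff_sum]
  refine Finset.sum_congr rfl fun α _ => ?_
  rw [coeff_sum]
  refine Finset.sum_congr rfl fun β _ => ?_
  rw [monomial_mul, coeff_monomial]

end FormOfCoeffs

theorem MvPolynomial.IsHomogeneous.not_isUnit {ι k : Type*} [Field k] {F : MvPolynomial ι k}
    {a : ℕ} (hF : F.IsHomogeneous a) (ha : a ≠ 0) : ¬ IsUnit F := by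
  intro h
  obtain ⟨G, hG⟩ := h.exists_right_inv
  have hF0 : F ≠ 0 := h.ne_zero
  have hG0 : G ≠ 0 := by
    rintro rfl
    simp at hG
  have := totalDegree_mul_of_isDomain hF0 hG0
  rw [hG, totalDegree_one, hF.totalDegree hF0] at this
  omega

/-- The equations, in the entries of a tensor `T` of format `a × b`, saying that `T` has rank at
most one and that the associated product of forms is proportional to `F`. -/
noncomputable def factorEquation {σ ι k : Type*} [Field k] [Fintype ι] [DecidableEq ι] (a b : ℕ)
    (F : MvPolynomial ι (MvPolynomial σ k)) :
    ((MonomialsOfDegree ι a × MonomialsOfDegree ι b) ×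
      (MonomialsOfDegree ι a × MonomialsOfDegree ι b)) ⊕ ((ι →₀ ℕ) × (ι →₀ ℕ)) →
    MvPolynomial (MonomialsOfDegree ι a × MonomialsOfDegree ι b) (MvPolynomial σ k)
  | .inl (p, q) => X p * X q - X (p.1, q.2) * X (q.1, p.2)
  | .inr (γ, δ) =>
    C (coeff δ F) * (∑ p : MonomialsOfDegree ι a × MonomialsOfDegree ι b,
      if (p.1 : ι →₀ ℕ) + (p.2 : ι →₀ ℕ) = γ then X p else 0) -
    C (coeff γ F) * (∑ p : MonomialsOfDegree ι a × MonomialsOfDegree ι b,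
      if (p.1 : ι →₀ ℕ) + (p.2 : ι →₀ ℕ) = δ then X p else 0)

/-- Nonzero solutions of `factorEquation` encode factorizations of type `(a, b)` up to scale. At
`c₀` there are none, so elimination applies. Passing to tensors makes the equations homogeneous in a
single set of unknowns. -/
theorem exists_forall_ne_mul {σ ι k : Type*} [Field k] [IsAlgClosed k] [Fintype ι]
    [DecidableEq ι] {a b : ℕ} (ha : a ≠ 0) (hb : b ≠ 0) (F : MvPolynomial ι (MvPolynomial σ k))
    (c₀ : σ → k) (hF : Irreducible (map (eval c₀) F)) :
    ∃ P : MvPolynomial σ k, eval c₀ P ≠ 0 ∧ ∀ c, eval c P ≠ 0 →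
      ∀ A B : MvPolynomial ι k, A.IsHomogeneous a → B.IsHomogeneous b → A * B ≠ 0 →
        map (eval c) F ≠ A * B := by
  have hlin : ∀ γ : ι →₀ ℕ, (∑ p : MonomialsOfDegree ι a × MonomialsOfDegree ι b,
      if (p.1 : ι →₀ ℕ) + (p.2 : ι →₀ ℕ) = γ then
        (X p : MvPolynomial _ (MvPolynomial σ k)) else 0).IsHomogeneous 1 := by
    intro γ
    refine IsHomogeneous.sum _ _ _ fun p _ => ?_
    split_ifs
    · exact isHomogeneous_X _ _
    · exact isHomogeneous_zero _ _ _
  have hG : ∀ j, (factorEquation a b F j).IsHomogeneous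
      (Sum.elim (fun _ => 2) (fun _ => 1) j) := by
    rintro (⟨p, q⟩ | ⟨γ, δ⟩)
    · exact ((isHomogeneous_X _ _).mul (isHomogeneous_X _ _)).sub
        ((isHomogeneous_X _ _).mul (isHomogeneous_X _ _))
    · exact ((hlin γ).C_mul _).sub ((hlin δ).C_mul _)
  have h₀ : ∀ T : MonomialsOfDegree ι a × MonomialsOfDegree ι b → k, T ≠ 0 →
      ∃ j, eval T (map (eval c₀) (factorEquation a b F j)) ≠ 0 := by
    intro T hT
    by_contra! hcon
    obtain ⟨⟨α₀, β₀⟩, hT0⟩ := Function.ne_iff.1 hT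
    -- The 2×2 minors through a nonzero entry show that `T` is, up to that scalar, the product of
    -- its row and column there.
    have hrank : ∀ α β, T (α, β₀) * T (α₀, β) = T (α₀, β₀) * T (α, β) := by
      intro α β
      have := hcon (.inl ((α₀, β₀), (α, β)))
      simp only [factorEquation, map_sub, map_mul, map_X, eval_X] at this
      linear_combination -this
    set A := formOfCoeffs fun α => T (α, β₀) with hA
    set B := formOfCoeffs fun β => T (α₀, β) with hB
    have hA0 : A ≠ 0 := by
      intro h
      have := coeff_formOfCoeffs (fun α => T (α, β₀)) α₀
      rw [← hA, h, coeff_zero] at this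
      exact hT0 this.symm
    have hB0 : B ≠ 0 := by
      intro h
      have := coeff_formOfCoeffs (fun β => T (α₀, β)) β₀
      rw [← hB, h, coeff_zero] at this
      exact hT0 this.symm
    have hcoeff : ∀ γ, coeff γ (A * B) = T (α₀, β₀) *
        ∑ p : MonomialsOfDegree ι a × MonomialsOfDegree ι b,
          if (p.1 : ι →₀ ℕ) + (p.2 : ι →₀ ℕ) = γ then T p else 0 := by
      intro γ
      rw [hA, hB, coeff_formOfCoeffs_mul, Finset.mul_sum]
      refine Finset.sum_congr rfl fun p _ => ?_
      rw [mul_ite, mul_zero, hrank]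
    obtain ⟨δ, hδ⟩ := MvPolynomial.ne_zero_iff.1 hF.ne_zero
    have hprop : C (coeff δ (map (eval c₀) F)) * (A * B) =
        C (coeff δ (A * B)) * map (eval c₀) F := by
      ext γ
      rw [coeff_C_mul, coeff_C_mul, hcoeff, hcoeff]
      have := hcon (.inr (γ, δ))
      simp only [factorEquation, map_sub, map_mul, map_C, eval_C, map_sum,
        apply_ite (map (eval c₀)), apply_ite (eval T), map_X, eval_X, map_zero] at this
      rw [coeff_map, coeff_map]
      linear_combination T (α₀, β₀) * this
    have hδ' : coeff δ (A * B) ≠ 0 := by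
      intro h
      rw [h, map_zero, zero_mul] at hprop
      exact mul_ne_zero (by simpa using hδ) (mul_ne_zero hA0 hB0) hprop
    have hunit : IsUnit (C (coeff δ (A * B)) : MvPolynomial ι k) := hδ'.isUnit.map C
    have hirr : Irreducible (C (coeff δ (A * B)) * map (eval c₀) F) :=
      (irreducible_isUnit_mul hunit).2 hF
    rw [← hprop, ← mul_assoc] at hirr
    have hA' : (C (coeff δ (map (eval c₀) F)) * A).IsHomogeneous a :=
      (formOfCoeffs_isHomogeneous _).C_mul _
    rcases hirr.isUnit_or_isUnit rfl with h | h
    · exact hA'.not_isUnit ha h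
    · exact (formOfCoeffs_isHomogeneous _).not_isUnit hb h
  obtain ⟨P, hP₀, hP⟩ := exists_forall_eval_ne_zero_of_no_common_zero (factorEquation a b F)
    _ hG c₀ h₀
  refine ⟨P, hP₀, fun c hc A B hA hB hAB hFAB => ?_⟩
  have hA0 : A ≠ 0 := left_ne_zero_of_mul hAB
  have hB0 : B ≠ 0 := right_ne_zero_of_mul hAB
  let T : MonomialsOfDegree ι a × MonomialsOfDegree ι b → k :=
    fun p => coeff (p.1 : ι →₀ ℕ) A * coeff (p.2 : ι →₀ ℕ) B
  have hmul : ∀ γ, (∑ p : MonomialsOfDegree ι a × MonomialsOfDegree ι b,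
      if (p.1 : ι →₀ ℕ) + (p.2 : ι →₀ ℕ) = γ then T p else 0) = coeff γ (A * B) := by
    intro γ
    conv_rhs => rw [← formOfCoeffs_coeff hA, ← formOfCoeffs_coeff hB]
    rw [coeff_formOfCoeffs_mul]
  have hT : T ≠ 0 := by
    intro hT
    refine hAB (MvPolynomial.ext _ _ fun γ => ?_)
    rw [← hmul γ, coeff_zero]
    refine Finset.sum_eq_zero fun p _ => ?_
    rw [hT]
    simp
  obtain ⟨j, hj⟩ := hP c hc T hT
  refine hj ?_
  rcases j with ⟨p, q⟩ | ⟨γ, δ⟩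
  · simp only [factorEquation, map_sub, map_mul, map_X, eval_X, T]
    ring
  · simp only [factorEquation, map_sub, map_mul, map_C, eval_C, map_sum, apply_ite (map (eval c)),
      apply_ite (eval T), map_X, eval_X, map_zero, hmul]
    rw [← hFAB, coeff_map, coeff_map]
    ring

/-- **Openness of irreducibility** for forms depending polynomially on a parameter. -/
theorem exists_forall_irreducible {σ ι k : Type*} [Field k] [IsAlgClosed k] [Finite ι]
    {D : ℕ} (hD : D ≠ 0) (F : MvPolynomial ι (MvPolynomial σ k)) (hFD : F.IsHomogeneous D)
    (c₀ : σ → k) (hF : Irreducible (map (eval c₀) F)) :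
    ∃ P : MvPolynomial σ k, eval c₀ P ≠ 0 ∧
      ∀ c, eval c P ≠ 0 → Irreducible (map (eval c) F) := by
  classical
  have := Fintype.ofFinite ι
  obtain ⟨δ, hδ⟩ := MvPolynomial.ne_zero_iff.1 hF.ne_zero
  have hex : ∀ a b : ℕ, ∃ P : MvPolynomial σ k, eval c₀ P ≠ 0 ∧ (a ≠ 0 → b ≠ 0 →
      ∀ c, eval c P ≠ 0 → ∀ A B : MvPolynomial ι k, A.IsHomogeneous a → B.IsHomogeneous b →
        A * B ≠ 0 → map (eval c) F ≠ A * B) := by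
    intro a b
    by_cases ha : a = 0
    · exact ⟨1, by simp, fun h => absurd ha h⟩
    by_cases hb : b = 0
    · exact ⟨1, by simp, fun _ h => absurd hb h⟩
    obtain ⟨P, h1, h2⟩ := exists_forall_ne_mul ha hb F c₀ hF
    exact ⟨P, h1, fun _ _ => h2⟩
  choose P hP₀ hP using hex
  -- Only finitely many degree splittings `a + b = D` occur; the factor `coeff δ F` keeps the
  -- specialized form nonzero.
  refine ⟨coeff δ F * ∏ p ∈ Finset.HasAntidiagonal.antidiagonal D, P p.1 p.2, ?_, fun c hc => ?_⟩
  · rw [map_mul, map_prod]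
    refine mul_ne_zero (by rwa [coeff_map] at hδ) (Finset.prod_ne_zero_iff.2 fun p _ => hP₀ _ _)
  · rw [map_mul, map_prod] at hc
    have hc1 := left_ne_zero_of_mul hc
    have hc2 := Finset.prod_ne_zero_iff.1 (right_ne_zero_of_mul hc)
    have hFc : map (eval c) F ≠ 0 := by
      intro h
      have := congrArg (coeff δ) h
      rw [coeff_map, coeff_zero] at this
      exact hc1 this
    have hFDc := hFD.map (eval c)
    refine ⟨hFDc.not_isUnit hD, fun A B hAB => ?_⟩
    have hAB0 : A * B ≠ 0 := hAB ▸ hFc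
    have hA := IsHomogeneous.of_mul_left (hAB ▸ hFDc) hAB0
    have hB := IsHomogeneous.of_mul_left (mul_comm A B ▸ hAB ▸ hFDc) (mul_comm A B ▸ hAB0)
    have hconst : ∀ {G : MvPolynomial ι k}, G ≠ 0 → G.totalDegree = 0 → IsUnit G := by
      intro G hG h
      rw [totalDegree_eq_zero_iff_eq_C] at h
      rw [h]
      refine IsUnit.map C (Ne.isUnit fun h0 => hG ?_)
      rw [h, h0, map_zero]
    by_cases ha : A.totalDegree = 0
    · exact Or.inl (hconst (left_ne_zero_of_mul hAB0) ha)
    by_cases hb : B.totalDegree = 0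
    · exact Or.inr (hconst (right_ne_zero_of_mul hAB0) hb)
    have hsum : (A.totalDegree, B.totalDegree) ∈ Finset.HasAntidiagonal.antidiagonal D := by
      rw [Finset.HasAntidiagonal.mem_antidiagonal, ← totalDegree_mul_of_isDomain (left_ne_zero_of_mul hAB0)
        (right_ne_zero_of_mul hAB0), ← hAB, hFDc.totalDegree hFc]
    exact absurd hAB (hP _ _ ha hb c (hc2 _ hsum) A B hA hB hAB0)

/-! ### A tuple with irreducible Jacobian determinant -/

section IrreducibleJacobian

variable {k : Type*} [Field k]

/-- The determinant of an arrow matrix, in a form avoiding division. -/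
theorem Matrix.det_arrow_mul {R : Type*} [CommRing R] {n : ℕ} (h : R) (u w D : Fin n → R) :
    (Matrix.of (Fin.cons (Fin.cons h u) fun j => Fin.cons (w j) (Pi.single j (D j))) :
      Matrix (Fin (n + 1)) (Fin (n + 1)) R).det * ∏ j, D j =
    (h * ∏ j, D j - ∑ j, u j * w j * ∏ l ∈ Finset.univ.erase j, D l) * ∏ j, D j := by
  classical
  set M : Matrix (Fin (n + 1)) (Fin (n + 1)) R :=
    Matrix.of (Fin.cons (Fin.cons h u) fun j => Fin.cons (w j) (Pi.single j (D j))) with hM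
  -- This combination of the columns clears the first column below the diagonal. It scales the
  -- determinant by `∏ D j`, whence the common factor on both sides.
  let v : Fin (n + 1) → R :=
    Fin.cons (∏ j, D j) fun j => - (w j * ∏ l ∈ Finset.univ.erase j, D l)
  let T : Matrix (Fin (n + 1)) (Fin (n + 1)) R :=
    Matrix.of fun i l => if l = 0 then v i else if i = l then 1 else 0
  have hT : T.det = ∏ j, D j := by
    rw [Matrix.det_of_isLowerTriangular]
    · rw [Fin.prod_univ_succ]
      simp [T, v, Matrix.of_apply]
    · intro i l hil
      have hil' : i < l := hil
      have hl : l ≠ 0 := (Fin.pos_of_ne_zero (Fin.ne_zero_of_lt hil')).ne'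
      simp [T, Matrix.of_apply, hl, hil'.ne]
  have hMT0 : ∀ i, (M * T) i 0 = ∑ l, M i l * v l := by
    intro i
    simp [Matrix.mul_apply, T]
  have hMTs : ∀ i (l : Fin n), (M * T) i l.succ = M i l.succ := by
    intro i l
    simp [Matrix.mul_apply, T, Fin.succ_ne_zero]
  have hMT : (M * T).det = (h * ∏ j, D j - ∑ j, u j * w j * ∏ l ∈ Finset.univ.erase j, D l) *
      ∏ j, D j := by
    rw [Matrix.det_of_isUpperTriangular]
    · rw [Fin.prod_univ_succ]
      congr 1
      · rw [hMT0, Fin.sum_univ_succ]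
        simp only [hM, Matrix.of_apply, Fin.cons_zero, Fin.cons_succ, v]
        rw [sub_eq_add_neg, ← Finset.sum_neg_distrib]
        congr 1
        exact Finset.sum_congr rfl fun j _ => by ring
      · refine Finset.prod_congr rfl fun j _ => ?_
        rw [hMTs]
        simp [hM]
    · intro i l hil
      have hil' : l < i := hil
      obtain ⟨i, rfl⟩ := Fin.exists_succ_eq.2 (Fin.ne_zero_of_lt hil')
      refine Fin.cases (fun _ => ?_) (fun l hl => ?_) l hil'
      · rw [hMT0, Fin.sum_univ_succ]
        simp only [hM, Matrix.of_apply, Fin.cons_zero, Fin.cons_succ, v]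
        rw [Finset.sum_eq_single i]
        · rw [Pi.single_eq_same, ← Finset.mul_prod_erase _ _ (Finset.mem_univ i)]
          ring
        · intro j _ hj
          rw [Pi.single_eq_of_ne hj, zero_mul]
        · simp
      · rw [hMTs]
        have : l ≠ i := fun h => (Fin.succ_lt_succ_iff.1 hl).ne h
        simp [hM, this]
  rw [← hMT, Matrix.det_mul, hT]

theorem prod_sub_sum_of_scaled {R : Type*} [CommRing R] {N : ℕ} (h a y z : R)
    (u w x : Fin (N + 1) → R) :
    h * ∏ j, a * x j - ∑ j, y * u j * (w j * (a * z)) * ∏ l ∈ Finset.univ.erase j, a * x l =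
      a ^ (N + 1) * (h * ∏ j, x j - y * z * ∑ j, u j * w j * ∏ l ∈ Finset.univ.erase j, x l) := by
  rw [mul_sub, Finset.mul_sum, Finset.mul_sum]
  congr 1
  · rw [Finset.prod_mul_distrib, Finset.prod_const, Finset.card_univ, Fintype.card_fin]
    ring
  · refine Finset.sum_congr rfl fun j _ => ?_
    rw [Finset.prod_mul_distrib, Finset.prod_const, Finset.card_erase_of_mem (Finset.mem_univ _),
      Finset.card_univ, Fintype.card_fin, Nat.add_sub_cancel]
    ring

/-- The linear form `x₀ + (c + 1) (x₁ + ⋯ + x_N)`. -/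
noncomputable def pencilForm (k : Type*) [Field k] (N c : ℕ) : MvPolynomial (Fin (N + 1)) k :=
  X 0 + C ((c : k) + 1) * ∑ j : Fin N, X j.succ

theorem pencilForm_prime (N c : ℕ) : Prime (pencilForm k N c) := by
  rw [← MulEquiv.prime_iff (finSuccEquiv k N)]
  -- As a polynomial in `x₀` the form is monic and linear.
  have : finSuccEquiv k N (pencilForm k N c) =
      Polynomial.X - Polynomial.C (- (C ((c : k) + 1) * ∑ j : Fin N, X j)) := by
    rw [pencilForm, map_add, map_mul, map_sum, finSuccEquiv_X_zero]
    simp only [finSuccEquiv_X_succ]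
    rw [map_neg, sub_neg_eq_add, map_mul, map_sum]
    congr 2
    exact (finSuccEquiv k N).commutes _
  rw [this]
  exact Polynomial.prime_X_sub_C _

/-- A product of `e` linear forms in the pencil spanned by `x₀` and `x₁ + ⋯ + x_N`. -/
noncomputable def pencilProduct (k : Type*) [Field k] (N e : ℕ) : MvPolynomial (Fin (N + 1)) k :=
  ∏ c ∈ Finset.range e, pencilForm k N c

theorem pencilForm_isHomogeneous (N c : ℕ) : (pencilForm k N c).IsHomogeneous 1 :=
  (isHomogeneous_X _ _).add ((IsHomogeneous.sum _ _ _ fun _ _ => isHomogeneous_X _ _).C_mul _)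

theorem pencilProduct_isHomogeneous (N e : ℕ) : (pencilProduct k N e).IsHomogeneous e := by
  have := IsHomogeneous.prod (Finset.range e) (fun c => pencilForm k N c) (fun _ => 1)
    fun c _ => pencilForm_isHomogeneous N c
  rw [pencilProduct]
  simpa using this

theorem pderiv_zero_pencilForm (N c : ℕ) : pderiv 0 (pencilForm k N c) = 1 := by
  simp [pencilForm, pderiv_X, Fin.succ_ne_zero]

theorem pderiv_succ_pencilForm (N c : ℕ) (j : Fin N) :
    pderiv j.succ (pencilForm k N c) = C ((c : k) + 1) := by
  simp [pencilForm, pderiv_X, Pi.single_apply]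

/-- The weights of the variables in the tuple of forms `pencilMap` below. -/
def pencilWeight (k : Type*) [Field k] {N : ℕ} (e : ℕ) : Fin (N + 1) → k :=
  Fin.cons 1 fun _ => (-1) ^ e

theorem pencilWeight_ne_zero {N : ℕ} (e : ℕ) (j : Fin (N + 1)) : pencilWeight k e j ≠ 0 := by
  refine Fin.cases ?_ (fun i => ?_) j <;> simp [pencilWeight]

/-- The coefficient of `-y ^ (e + 1)` in the Jacobian determinant computed below. -/
noncomputable def pencilPolar (k : Type*) [Field k] (N e : ℕ) : MvPolynomial (Fin (N + 1)) k :=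
  ∑ j, pderiv j (pencilProduct k N e) * C (pencilWeight k e j) *
    ∏ l ∈ Finset.univ.erase j, X l ^ e

theorem pencilForm_dvd_pencilProduct {N e c : ℕ} (hc : c < e) :
    pencilForm k N c ∣ pencilProduct k N e :=
  Finset.dvd_prod_of_mem _ (Finset.mem_range.2 hc)

theorem eval_pencilPolar_of_zero_one {N e : ℕ} (he : e ≠ 0) (l : Fin (N + 1)) :
    eval (fun i => if i = l then 0 else 1) (pencilPolar k N e) =
      eval (fun i => if i = l then 0 else 1) (pderiv l (pencilProduct k N e)) *
        pencilWeight k e l := by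
  rw [pencilPolar, map_sum, Finset.sum_eq_single l]
  · have : eval (fun i => if i = l then (0 : k) else 1) (∏ m ∈ Finset.univ.erase l,
        (X m : MvPolynomial (Fin (N + 1)) k) ^ e) = 1 := by
      rw [map_prod]
      refine Finset.prod_eq_one fun m hm => ?_
      simp [Finset.ne_of_mem_erase hm]
    rw [map_mul, map_mul, this, mul_one, eval_C]
  · intro j _ hj
    rw [map_mul, map_prod, Finset.prod_eq_zero (i := l), mul_zero]
    · exact Finset.mem_erase.2 ⟨hj.symm, Finset.mem_univ _⟩
    · simp [he]
  · simp

/-- At the point with coordinate `l` zero and all others one, a single summand survives. It is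
nonzero by positivity: all linear forms and their derivatives take positive integer values there, a
property kept by the product rule. -/
theorem not_X_dvd_pencilPolar [CharZero k] {N e : ℕ} (hN : N ≠ 0) (he : e ≠ 0)
    (l : Fin (N + 1)) : ¬ X l ∣ pencilPolar k N e := by
  classical
  rintro ⟨g, hg⟩
  set z : Fin (N + 1) → k := fun i => if i = l then 0 else 1 with hz
  have h0 := eval_pencilPolar_of_zero_one (k := k) he l
  have hzl : z l = 0 := by simp [hz]
  rw [← hz, hg, map_mul, eval_X, hzl, zero_mul] at h0
  have hform : ∀ c, ∃ a b : ℕ, a ≠ 0 ∧ b ≠ 0 ∧ eval z (pencilForm k N c) = a ∧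
      eval z (pderiv l (pencilForm k N c)) = b := by
    intro c
    cases l using Fin.cases with
    | zero =>
      refine ⟨(c + 1) * N, 1, mul_ne_zero (Nat.succ_ne_zero c) hN, one_ne_zero, ?_, ?_⟩
      · have hs : ∀ j : Fin N, z j.succ = 1 := fun j => if_neg (Fin.succ_ne_zero j)
        simp only [pencilForm, map_add, map_mul, map_sum, eval_X, eval_C, hzl, hs]
        simp
      · simp [pderiv_zero_pencilForm]
    | succ i =>
      refine ⟨1 + (c + 1) * (Finset.univ.erase i).card, c + 1, by omega, by omega, ?_, ?_⟩
      · have : ∑ j : Fin N, (if j = i then (0 : k) else 1) = ((Finset.univ.erase i).card : k) := by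
          rw [← Finset.add_sum_erase _ _ (Finset.mem_univ i), if_pos rfl, zero_add,
            Finset.sum_congr rfl fun j hj => if_neg (Finset.ne_of_mem_erase hj)]
          simp
        simp only [pencilForm, hz, map_add, map_mul, map_sum, eval_X, eval_C, Fin.succ_inj, this,
          (Fin.succ_ne_zero i).symm, if_false]
        push_cast
        ring
      · simp [pderiv_succ_pencilForm]
  have hprod : ∀ e : ℕ, ∃ a b : ℕ, a ≠ 0 ∧ (e ≠ 0 → b ≠ 0) ∧ eval z (pencilProduct k N e) = a ∧
      eval z (pderiv l (pencilProduct k N e)) = b := by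
    intro e
    induction e with
    | zero => exact ⟨1, 0, one_ne_zero, fun h => absurd rfl h, by simp [pencilProduct],
        by simp [pencilProduct]⟩
    | succ e ih =>
      obtain ⟨a, b, ha, -, h1, h2⟩ := ih
      obtain ⟨a', b', ha', hb', h1', h2'⟩ := hform e
      refine ⟨a * a', a * b' + a' * b, mul_ne_zero ha ha', fun _ => by positivity, ?_, ?_⟩
      · rw [pencilProduct, Finset.prod_range_succ, map_mul, ← pencilProduct, h1, h1']
        push_cast
        ring
      · rw [pencilProduct, Finset.prod_range_succ, ← pencilProduct, Derivation.leibniz,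
          smul_eq_mul, smul_eq_mul, map_add, map_mul, map_mul, h1, h1', h2, h2']
        push_cast
        ring
  obtain ⟨a, b, -, hb, -, h2⟩ := hprod e
  rw [h2] at h0
  exact mul_ne_zero (Nat.cast_ne_zero.2 (hb he)) (pencilWeight_ne_zero e l) h0.symm

/-- A point on the hyperplane `pencilForm k N c = 0`. -/
def pencilPoint (k : Type*) [Field k] (N c : ℕ) : Fin (N + 1) → k :=
  Fin.cons (-(((c : k) + 1) * N)) fun _ => 1

theorem eval_pencilForm_pencilPoint (N c c' : ℕ) :
    eval (pencilPoint k N c) (pencilForm k N c') = ((c' : k) - c) * N := by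
  simp [pencilForm, pencilPoint]
  ring

theorem not_pencilForm_dvd_pencilPolar [CharZero k] {N e : ℕ} (hN : N ≠ 0) {c : ℕ}
    (hc : c < e) : ¬ pencilForm k N c ∣ pencilPolar k N e := by
  classical
  rintro ⟨g, hg⟩
  set z := pencilPoint k N c with hz
  have hzero : eval z (pencilForm k N c) = 0 := by
    rw [hz, eval_pencilForm_pencilPoint, sub_self, zero_mul]
  have h0 : eval z (pencilPolar k N e) = 0 := by
    rw [hg, map_mul, hzero, zero_mul]
  set h := eval z (∏ c' ∈ (Finset.range e).erase c, pencilForm k N c') with hh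
  have hne : h ≠ 0 := by
    rw [hh, map_prod]
    refine Finset.prod_ne_zero_iff.2 fun c' hc' => ?_
    rw [hz, eval_pencilForm_pencilPoint]
    refine mul_ne_zero (sub_ne_zero.2 fun h => ?_) (Nat.cast_ne_zero.2 hN)
    exact Finset.ne_of_mem_erase hc' (Nat.cast_injective h)
  have hder : ∀ j, eval z (pderiv j (pencilProduct k N e)) =
      h * eval z (pderiv j (pencilForm k N c)) := by
    intro j
    rw [pencilProduct, ← Finset.mul_prod_erase _ _ (Finset.mem_range.2 hc), Derivation.leibniz,
      smul_eq_mul, smul_eq_mul, map_add, map_mul, map_mul, hzero, zero_mul, zero_add]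
  have hprod0 : ∏ l ∈ Finset.univ.erase (0 : Fin (N + 1)), z l ^ e = 1 := by
    refine Finset.prod_eq_one fun l hl => ?_
    obtain ⟨i, rfl⟩ := Fin.exists_succ_eq.2 (Finset.ne_of_mem_erase hl)
    simp [hz, pencilPoint]
  have hprods : ∀ j : Fin N, ∏ l ∈ Finset.univ.erase j.succ, z l ^ e =
      (-(((c : k) + 1) * N)) ^ e := by
    intro j
    rw [Finset.prod_eq_single (0 : Fin (N + 1))]
    · simp [hz, pencilPoint]
    · intro l _ hl
      obtain ⟨i, rfl⟩ := Fin.exists_succ_eq.2 hl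
      simp [hz, pencilPoint]
    · intro hmem
      exact absurd (Finset.mem_erase.2 ⟨(Fin.succ_ne_zero j).symm, Finset.mem_univ _⟩) hmem
  -- The sign `(-1) ^ e` from the first coordinate of `pencilPoint` cancels the sign in
  -- `pencilWeight`, so the second factor is a positive integer. This is the reason for the weights.
  have heval : eval z (pencilPolar k N e) =
      h * ((1 + N * ((c + 1) * ((c + 1) * N) ^ e) : ℕ) : k) := by
    rw [pencilPolar, map_sum, Fin.sum_univ_succ]
    simp only [map_mul, hder, map_prod, map_pow, eval_X, eval_C, hprod0, hprods,
      pderiv_zero_pencilForm, pderiv_succ_pencilForm, pencilWeight, Fin.cons_zero, Fin.cons_succ,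
      map_one, Finset.sum_const, Finset.card_univ, Fintype.card_fin, nsmul_eq_mul]
    rw [neg_pow (((c : k) + 1) * N) e]
    have h1 : ((-1 : k) ^ e) * (-1) ^ e = 1 := by
      rw [← mul_pow]
      simp
    push_cast
    linear_combination (N * h * (c + 1) * ((c + 1) * N) ^ e : k) * h1
  rw [heval] at h0
  refine mul_ne_zero hne (Nat.cast_ne_zero.2 ?_) h0
  positivity

/-- After cancelling one copy of the form, the remaining product is nonzero at `pencilPoint`, where
the form vanishes. -/
theorem not_sq_pencilForm_dvd [CharZero k] {N e : ℕ} (hN : N ≠ 0) (he : e ≠ 0) :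
    ¬ pencilForm k N 0 ^ 2 ∣ pencilProduct k N e * ∏ j, X j ^ e := by
  rintro ⟨g, hg⟩
  obtain ⟨f, hf⟩ : ∃ f, pencilProduct k N e = pencilForm k N 0 * f ∧
      eval (pencilPoint k N 0) f ≠ 0 := by
    refine ⟨∏ c ∈ (Finset.range e).erase 0, pencilForm k N c, ?_, ?_⟩
    · rw [pencilProduct, Finset.mul_prod_erase _ _ (Finset.mem_range.2 (Nat.pos_of_ne_zero he))]
    · rw [map_prod]
      refine Finset.prod_ne_zero_iff.2 fun c hc => ?_
      rw [eval_pencilForm_pencilPoint, Nat.cast_zero, sub_zero]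
      exact mul_ne_zero (Nat.cast_ne_zero.2 (Finset.ne_of_mem_erase hc)) (Nat.cast_ne_zero.2 hN)
  rw [hf.1, sq, mul_assoc, mul_assoc] at hg
  have h2 := congrArg (eval (pencilPoint k N 0))
    (mul_left_cancel₀ (pencilForm_prime N 0).ne_zero hg)
  rw [map_mul _ (pencilForm k N 0), eval_pencilForm_pencilPoint, sub_self, zero_mul, zero_mul,
    map_mul, map_prod] at h2
  refine mul_ne_zero hf.2 (Finset.prod_ne_zero_iff.2 fun j _ => ?_) h2
  rw [map_pow, eval_X]
  refine pow_ne_zero _ ?_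
  refine Fin.cases ?_ (fun i => ?_) j
  · simp [pencilPoint, hN]
  · simp [pencilPoint]

theorem finSuccEquiv_rename_succ {N : ℕ} (f : MvPolynomial (Fin N) k) :
    finSuccEquiv k N (rename Fin.succ f) = Polynomial.C f := by
  have : ((finSuccEquiv k N).toAlgHom.comp (rename Fin.succ)) =
      (Polynomial.CAlgHom : MvPolynomial (Fin N) k →ₐ[k] _) := by
    refine algHom_ext fun i => ?_
    simp [finSuccEquiv_X_succ]
  exact DFunLike.congr_fun this f

theorem pderiv_zero_rename_succ {N : ℕ} (f : MvPolynomial (Fin N) k) :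
    pderiv 0 (rename Fin.succ f) = 0 := by
  classical
  refine pderiv_eq_zero_of_notMem_vars fun h => ?_
  obtain ⟨i, -, hi⟩ := Finset.mem_image.1 (vars_rename Fin.succ f h)
  exact Fin.succ_ne_zero i hi

/-- The Jacobian determinant computed below, up to a constant. -/
noncomputable def pencilJacobian (k : Type*) [Field k] (N e : ℕ) :
    MvPolynomial (Fin (N + 2)) k :=
  rename Fin.succ (pencilProduct k N e) * ∏ j : Fin (N + 1), X j.succ ^ e -
    X 0 ^ (e + 1) * rename Fin.succ (pencilPolar k N e)

theorem finSuccEquiv_pencilJacobian (N e : ℕ) :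
    finSuccEquiv k (N + 1) (pencilJacobian k N e) =
      Polynomial.C (pencilProduct k N e * ∏ j, X j ^ e) -
        Polynomial.C (pencilPolar k N e) * Polynomial.X ^ (e + 1) := by
  rw [pencilJacobian, map_sub, map_mul, map_mul, map_pow, map_prod, finSuccEquiv_X_zero,
    finSuccEquiv_rename_succ, finSuccEquiv_rename_succ]
  simp only [map_pow, finSuccEquiv_X_succ, map_mul, map_prod]
  ring

/-- In the first variable `y` this is `A - B y ^ (e + 1)`. Eisenstein applies at the linear form
`pencilForm k N 0`, which divides `A` exactly once and does not divide `B`. -/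
theorem pencilJacobian_irreducible [CharZero k] {N e : ℕ} (hN : N ≠ 0) (he : e ≠ 0) :
    Irreducible (pencilJacobian k N e) := by
  classical
  rw [← MulEquiv.irreducible_iff (finSuccEquiv k (N + 1)), finSuccEquiv_pencilJacobian]
  set A := pencilProduct k N e * ∏ j, X j ^ e with hA
  set B := pencilPolar k N e with hB
  have hB0 : B ≠ 0 := by
    intro h
    refine not_X_dvd_pencilPolar (k := k) hN he 0 ?_
    rw [← hB, h]
    exact dvd_zero _
  have hcoeff : ∀ i, (Polynomial.C A - Polynomial.C B * Polynomial.X ^ (e + 1)).coeff i =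
      (if i = 0 then A else 0) - (if i = e + 1 then B else 0) := by
    intro i
    rw [Polynomial.coeff_sub, Polynomial.coeff_C, Polynomial.coeff_C_mul_X_pow]
  have hdeg : (Polynomial.C A - Polynomial.C B * Polynomial.X ^ (e + 1)).natDegree = e + 1 := by
    refine le_antisymm (Polynomial.natDegree_le_iff_coeff_eq_zero.2 fun i hi => ?_) ?_
    · rw [hcoeff, if_neg (by omega), if_neg (by omega), sub_zero]
    · refine Polynomial.le_natDegree_of_ne_zero ?_
      rw [hcoeff, if_neg (by omega), if_pos rfl, zero_sub]
      exact neg_ne_zero.2 hB0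
  have hne : Polynomial.C A - Polynomial.C B * Polynomial.X ^ (e + 1) ≠ 0 := by
    intro h
    rw [h] at hdeg
    simp at hdeg
  have hp := pencilForm_prime (k := k) N 0
  have hpA : pencilForm k N 0 ∣ A :=
    (pencilForm_dvd_pencilProduct (Nat.pos_of_ne_zero he)).trans (dvd_mul_right _ _)
  refine Polynomial.irreducible_of_eisenstein_criterion
    (P := Ideal.span {pencilForm k N 0}) ?_ ?_ ?_ ?_ ?_ ?_
  · exact (Ideal.span_singleton_prime hp.ne_zero).2 hp
  · rw [Polynomial.leadingCoeff, hdeg, hcoeff, if_neg (by omega), if_pos rfl, zero_sub,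
      Ideal.mem_span_singleton, dvd_neg]
    exact not_pencilForm_dvd_pencilPolar hN (Nat.pos_of_ne_zero he)
  · intro i hi
    rw [Polynomial.degree_eq_natDegree hne, hdeg] at hi
    have hi' : i < e + 1 := by exact_mod_cast hi
    rw [hcoeff, if_neg hi'.ne, sub_zero, Ideal.mem_span_singleton]
    split_ifs
    · exact hpA
    · exact dvd_zero _
  · rw [Polynomial.degree_eq_natDegree hne, hdeg]
    exact_mod_cast Nat.succ_pos e
  · rw [hcoeff, if_pos rfl, if_neg (by omega), sub_zero, Ideal.span_singleton_pow,
      Ideal.mem_span_singleton]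
    exact not_sq_pencilForm_dvd hN he
  -- Primitivity: the prime factors of `A` are the pencil forms and the variables, and none of them
  -- divides `B`.
  · intro r hr
    rw [Polynomial.C_dvd_iff_dvd_coeff] at hr
    have hrA : r ∣ A := by
      have := hr 0
      rwa [hcoeff, if_pos rfl, if_neg (by omega), sub_zero] at this
    have hrB : r ∣ B := by
      have := hr (e + 1)
      rwa [hcoeff, if_neg (by omega), if_pos rfl, zero_sub, dvd_neg] at this
    by_contra hunit
    obtain ⟨p, hpi, hpr⟩ := WfDvdMonoid.exists_irreducible_factor hunit
      (ne_zero_of_dvd_ne_zero hB0 hrB)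
    have hpp := hpi.prime
    rcases hpp.dvd_or_dvd (hpr.trans hrA) with h | h
    · obtain ⟨c, hc, hpc⟩ := (hpp.dvd_finsetProd_iff _).1 h
      have hass := (hpi.associated_of_dvd (pencilForm_prime N c).irreducible hpc).symm.dvd
      exact not_pencilForm_dvd_pencilPolar hN (Finset.mem_range.1 hc)
        (hass.trans (hpr.trans hrB))
    · obtain ⟨j, -, hpj⟩ := (hpp.dvd_finsetProd_iff _).1 h
      have hpj := hpp.dvd_of_dvd_pow hpj
      have hass := (hpi.associated_of_dvd (X_prime (i := j)).irreducible hpj).symm.dvd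
      exact not_X_dvd_pencilPolar hN he j (hass.trans (hpr.trans hrB))

/-- A tuple of forms of degree `e + 1` in `N + 2` variables whose Jacobian determinant is
irreducible. -/
noncomputable def pencilMap (k : Type*) [Field k] (N e : ℕ) :
    Fin (N + 2) → MvPolynomial (Fin (N + 2)) k :=
  Fin.cons (X 0 * rename Fin.succ (pencilProduct k N e)) fun j =>
    X j.succ ^ (e + 1) + C (pencilWeight k e j) * X 0 ^ (e + 1)

theorem pencilMap_isHomogeneous (N e : ℕ) (i : Fin (N + 2)) :
    (pencilMap k N e i).IsHomogeneous (e + 1) := by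
  refine Fin.cases ?_ (fun j => ?_) i
  · have := (isHomogeneous_X k (0 : Fin (N + 2))).mul ((pencilProduct_isHomogeneous (k := k) N e).rename_isHomogeneous
      (f := Fin.succ))
    rwa [add_comm 1 e] at this
  · exact (isHomogeneous_X_pow _ _).add ((isHomogeneous_X_pow _ _).C_mul _)

/-- The first form is linear in `x₀`, and each other form involves only `x₀` and its own variable,
so the Jacobian matrix is an arrow matrix. -/
theorem det_pencilMap [CharZero k] (N e : ℕ) :
    (Matrix.of fun i j => pderiv j (pencilMap k N e i)).det =
      C (((e : k) + 1) ^ (N + 1)) * pencilJacobian k N e := by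
  have hmat : (Matrix.of fun i j => pderiv j (pencilMap k N e i)) =
      Matrix.of (Fin.cons (Fin.cons (rename Fin.succ (pencilProduct k N e))
        fun j => X 0 * rename Fin.succ (pderiv j (pencilProduct k N e)))
        fun j => Fin.cons (C (pencilWeight k e j) * (C ((e : k) + 1) * X 0 ^ e))
          (Pi.single j (C ((e : k) + 1) * X j.succ ^ e))) := by
    have hC : (C ((e : k) + 1) : MvPolynomial (Fin (N + 2)) k) = (e : MvPolynomial _ k) + 1 := by
      simp
    ext1 i j
    refine Fin.cases ?_ (fun i => ?_) i <;> refine Fin.cases ?_ (fun j => ?_) j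
    · simp [pencilMap, pderiv_X, Derivation.leibniz, pderiv_zero_rename_succ]
    · simp [pencilMap, pderiv_X, Derivation.leibniz, pderiv_rename (Fin.succ_injective _),
        Fin.succ_ne_zero]
    · simp [pencilMap, pderiv_X, Derivation.leibniz, Derivation.leibniz_pow, Fin.succ_ne_zero, hC]
    · by_cases h : j = i
      · subst h
        simp [pencilMap, pderiv_X, Derivation.leibniz, Derivation.leibniz_pow, Fin.succ_ne_zero, hC]
      · have h' : j.succ ≠ i.succ := fun h' => h (Fin.succ_injective _ h')
        simp [pencilMap, pderiv_X, Derivation.leibniz, Derivation.leibniz_pow, Fin.succ_ne_zero, h]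
  have hdet := Matrix.det_arrow_mul (rename Fin.succ (pencilProduct k N e))
    (fun j => X 0 * rename Fin.succ (pderiv j (pencilProduct k N e)))
    (fun j => C (pencilWeight k e j) * (C ((e : k) + 1) * X 0 ^ e))
    (fun j : Fin (N + 1) => C ((e : k) + 1) * X j.succ ^ e)
  rw [← hmat] at hdet
  have hne : ∏ j : Fin (N + 1), (C ((e : k) + 1) * X j.succ ^ e : MvPolynomial (Fin (N + 2)) k)
      ≠ 0 := by
    refine Finset.prod_ne_zero_iff.2 fun j _ => mul_ne_zero ?_ (pow_ne_zero _ (X_ne_zero _))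
    rw [Ne, map_eq_zero_iff _ (C_injective _ _)]
    exact Nat.cast_add_one_ne_zero e
  have hE := mul_right_cancel₀ hne hdet
  rw [hE, prod_sub_sum_of_scaled, pencilJacobian, pencilPolar, map_pow, map_sum]
  simp only [map_mul, map_prod, map_pow, rename_X, rename_C, pow_succ']

end IrreducibleJacobian

namespace DynImproper

/-! ### Tuples of forms over a commutative ring -/

section GenericForm

variable {R S : Type*} [CommRing R] [CommRing S] {n d : ℕ}

/-- The `i`-th form of the tuple with coefficient vector `c`, over a commutative ring. -/
noncomputable def genForm (c : CoeffIndex n d → R) (i : Fin (n + 1)) :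
    MvPolynomial (Fin (n + 1)) R :=
  formOfCoeffs fun α => c (i, α)

/-- The Jacobian determinant of the tuple with coefficient vector `c`, over a commutative ring. -/
noncomputable def genJacobian (c : CoeffIndex n d → R) : MvPolynomial (Fin (n + 1)) R :=
  (Matrix.of fun i j => pderiv j (genForm c i)).det

theorem genForm_isHomogeneous (c : CoeffIndex n d → R) (i : Fin (n + 1)) :
    (genForm c i).IsHomogeneous d :=
  formOfCoeffs_isHomogeneous _

theorem map_genForm (φ : R →+* S) (c : CoeffIndex n d → R) (i : Fin (n + 1)) :
    map φ (genForm c i) = genForm (fun a => φ (c a)) i := by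
  simp [genForm, formOfCoeffs, map_sum, map_monomial]

theorem map_genJacobian (φ : R →+* S) (c : CoeffIndex n d → R) :
    map φ (genJacobian c) = genJacobian (fun a => φ (c a)) := by
  rw [genJacobian, genJacobian, RingHom.map_det]
  congr 1
  ext1 i j
  simp [← map_genForm, pderiv_map]

theorem genJacobian_isHomogeneous (c : CoeffIndex n d → R) :
    (genJacobian c).IsHomogeneous ((n + 1) * (d - 1)) := by
  rw [genJacobian, Matrix.det_apply]
  refine IsHomogeneous.sum _ _ _ fun σ _ => ?_
  have h : (∏ i, (Matrix.of fun i j => pderiv j (genForm c i)) (σ i) i).IsHomogeneous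
      ((n + 1) * (d - 1)) := by
    have := IsHomogeneous.prod Finset.univ
      (fun i => (Matrix.of fun i j => pderiv j (genForm c i)) (σ i) i) (fun _ => d - 1)
      fun i _ => (genForm_isHomogeneous c (σ i)).pderiv
    simpa using this
  rcases Int.units_eq_one_or (Equiv.Perm.sign σ) with h1 | h1 <;> rw [h1]
  · simpa using h
  · simpa using h.neg

/-- The coefficient vector of a tuple of polynomials. -/
noncomputable def coeffVector (d : ℕ) (F : Fin (n + 1) → MvPolynomial (Fin (n + 1)) R) :
    CoeffIndex n d → R :=
  fun a => coeff (a.2 : Fin (n + 1) →₀ ℕ) (F a.1)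

theorem genForm_coeffVector {F : Fin (n + 1) → MvPolynomial (Fin (n + 1)) R}
    (hF : ∀ i, (F i).IsHomogeneous d) (i : Fin (n + 1)) :
    genForm (coeffVector d F) i = F i :=
  formOfCoeffs_coeff (hF i)

end GenericForm

/-! ### The skew family and its two-parameter deformation -/

section SpecialFamily

variable {A B : Type*} [CommRing A] [CommRing B] {m : ℕ} (e : ℕ)

/-- The tuple `(x₀ᵈ, x₁ᵈ, xᵢ (x₁ - t x₀) x₀ᵈ⁻²)`, `d = e + 2`. -/
noncomputable def skewForm (t : A) : Fin (m + 2) → MvPolynomial (Fin (m + 2)) A :=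
  Fin.cons (X 0 ^ (e + 2)) (Fin.cons (X 1 ^ (e + 2)) fun i : Fin m =>
    X i.succ.succ * ((X 1 - C t * X 0) * X 0 ^ e))

theorem skewForm_isHomogeneous (t : A) (i : Fin (m + 2)) :
    (skewForm e t i).IsHomogeneous (e + 2) := by
  refine Fin.cases ?_ (fun i => Fin.cases ?_ (fun i => ?_) i) i
  · exact isHomogeneous_X_pow _ _
  · exact isHomogeneous_X_pow _ _
  · have := (isHomogeneous_X A i.succ.succ).mul
      (((isHomogeneous_X A (1 : Fin (m + 2))).sub (isHomogeneous_C_mul_X t 0)).mul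
        (isHomogeneous_X_pow (R := A) (0 : Fin (m + 2)) e))
    have he : 1 + (1 + e) = e + 2 := by ring
    rwa [he] at this

theorem map_skewForm (ψ : A →+* B) (t : A) (i : Fin (m + 2)) :
    map ψ (skewForm e t i) = skewForm e (ψ t) i := by
  refine Fin.cases ?_ (fun i => Fin.cases ?_ (fun i => ?_) i) i <;> simp [skewForm]

/-- The first two forms are powers of `x₀` and `x₁`, and each later one involves only `x₀`, `x₁` and
its own variable: the matrix is lower triangular. -/
theorem det_skewForm (t : A) :
    (Matrix.of fun i j => pderiv j (skewForm (m := m) e t i)).det =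
      (C ((e : A) + 2) * X 0 ^ (e + 1)) * (C ((e : A) + 2) * X 1 ^ (e + 1)) *
        ((X 1 - C t * X 0) * X 0 ^ e) ^ m := by
  have hC : (C ((e : A) + 2) : MvPolynomial (Fin (m + 2)) A) = (e : MvPolynomial _ A) + 2 := by
    rw [map_add, map_natCast, map_ofNat]
  rw [Matrix.det_of_isLowerTriangular, Fin.prod_univ_succ, Fin.prod_univ_succ, ← mul_assoc]
  · congr 1
    · congr 1
      · simp [skewForm, Derivation.leibniz_pow, hC]
      · simp [skewForm, Derivation.leibniz_pow, hC]
    · simp only [Matrix.of_apply, skewForm, Fin.cons_succ]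
      have : ∀ i : Fin m, pderiv i.succ.succ (X i.succ.succ * ((X 1 - C t * X 0) * X 0 ^ e)) =
          ((X 1 - C t * X 0) * X 0 ^ e : MvPolynomial (Fin (m + 2)) A) := by
        intro i
        have h0 : pderiv i.succ.succ (X 0 : MvPolynomial (Fin (m + 2)) A) = 0 :=
          pderiv_X_of_ne (Fin.succ_ne_zero _).symm
        have h1 : pderiv i.succ.succ (X 1 : MvPolynomial (Fin (m + 2)) A) = 0 :=
          pderiv_X_of_ne fun h =>
            Fin.succ_ne_zero i (Fin.succ_injective _ (h.symm.trans Fin.succ_zero_eq_one.symm))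
        simp [Derivation.leibniz, Derivation.leibniz_pow, h0, h1]
      simp [this]
  · intro i j hij
    have hij' : i < j := hij
    have h0 : ∀ j : Fin (m + 2), 0 < j → pderiv j (X 0 : MvPolynomial (Fin (m + 2)) A) = 0 :=
      fun j hj => pderiv_X_of_ne hj.ne
    have h1 : ∀ j : Fin (m + 2), 1 < j → pderiv j (X 1 : MvPolynomial (Fin (m + 2)) A) = 0 :=
      fun j hj => pderiv_X_of_ne hj.ne
    have hj0 : 0 < j := (Fin.zero_le i).trans_lt hij'
    rw [Matrix.of_apply]
    revert hij'
    refine Fin.cases (fun _ => ?_) (fun i => Fin.cases (fun hij => ?_) (fun i hij => ?_) i) i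
    · simp [skewForm, Derivation.leibniz_pow, h0 j hj0]
    · simp [skewForm, Derivation.leibniz_pow, h1 j hij]
    · have hj1 : 1 < j := lt_trans (by
        rw [← Fin.succ_zero_eq_one]
        exact Fin.succ_lt_succ_iff.2 (Fin.succ_pos i)) hij
      have hX : pderiv j (X i.succ.succ : MvPolynomial (Fin (m + 2)) A) = 0 :=
        pderiv_X_of_ne hij.ne
      simp [skewForm, Derivation.leibniz, Derivation.leibniz_pow, h0 j hj0, h1 j hj1, hX]

variable {k : Type*} [Field k]

/-- The coefficients of the two-parameter family through the skew family and the tuple with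
coefficient vector `c₁`. -/
noncomputable def familyCoeffs (φ : k →+* A) (c₁ : CoeffIndex (m + 1) (e + 2) → k) (t s : A) :
    CoeffIndex (m + 1) (e + 2) → A :=
  fun a => coeffVector (e + 2) (skewForm e t) a +
    s * φ (c₁ a - coeffVector (e + 2) (skewForm e 0) a)

variable {e}

theorem map_familyCoeffs (φ : k →+* A) (ψ : A →+* B) (c₁ : CoeffIndex (m + 1) (e + 2) → k)
    (t s : A) (a : CoeffIndex (m + 1) (e + 2)) :
    ψ (familyCoeffs e φ c₁ t s a) = familyCoeffs e (ψ.comp φ) c₁ (ψ t) (ψ s) a := by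
  simp only [familyCoeffs, map_add, map_mul, RingHom.comp_apply, coeffVector, ← map_skewForm,
    coeff_map]

/-- The family passes through `c₁`, so a polynomial nonzero at `c₁` does not vanish identically on
the family. -/
theorem familyCoeffs_zero_one (φ : k →+* k) (hφ : φ = RingHom.id k)
    (c₁ : CoeffIndex (m + 1) (e + 2) → k) :
    familyCoeffs e φ c₁ 0 1 = c₁ := by
  ext a
  simp [familyCoeffs, hφ]

theorem genForm_familyCoeffs_zero (φ : k →+* A) (c₁ : CoeffIndex (m + 1) (e + 2) → k) (t : A)
    (i : Fin (m + 2)) : genForm (familyCoeffs e φ c₁ t 0) i = skewForm e t i := by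
  have : familyCoeffs e φ c₁ t 0 = coeffVector (e + 2) (skewForm e t) := by
    ext a
    simp [familyCoeffs]
  rw [this]
  exact genForm_coeffVector (skewForm_isHomogeneous e t) i

theorem genJacobian_familyCoeffs_zero (φ : k →+* A) (c₁ : CoeffIndex (m + 1) (e + 2) → k)
    (t : A) : genJacobian (familyCoeffs e φ c₁ t 0) =
      (C ((e : A) + 2) * X 0 ^ (e + 1)) * (C ((e : A) + 2) * X 1 ^ (e + 1)) *
        ((X 1 - C t * X 0) * X 0 ^ e) ^ m := by
  rw [genJacobian, ← det_skewForm]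
  simp only [genForm_familyCoeffs_zero]

end SpecialFamily

end DynImproper

namespace DynImproper

/-! ### Density of periodic critical points -/

section PeriodicCriticalPoint

variable {k : Type*} [Field k]

/-- A simple root of a one-variable polynomial is isolated. -/
theorem X_sub_C_mem_of_simple_root {τ : Type*} {q : Ideal (MvPolynomial τ k)} (hq : q.IsPrime)
    {z : τ → k} (hqz : q ≤ RingHom.ker (eval z)) (v : τ) (f : Polynomial k)
    (hf : f.IsRoot (z v)) (hf' : f.derivative.eval (z v) ≠ 0)
    (hmem : Polynomial.aeval (X v : MvPolynomial τ k) f ∈ q) : X v - C (z v) ∈ q := by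
  obtain ⟨g, hg⟩ := Polynomial.dvd_iff_isRoot.2 hf
  have hgz : g.eval (z v) ≠ 0 := by
    rw [hg] at hf'
    simpa using hf'
  rw [hg, map_mul] at hmem
  refine Eq.mp ?_ ((hq.mem_or_mem hmem).resolve_right fun h => hgz ?_)
  · simp [algebraMap_eq]
  · have h1 : eval z (Polynomial.aeval (X v : MvPolynomial τ k) g) = 0 := hqz h
    have h2 : eval z (Polynomial.aeval (X v : MvPolynomial τ k) g) = g.eval (z v) := by
      have hid : (eval z).comp (algebraMap k (MvPolynomial τ k)) = RingHom.id k := by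
        ext a
        simp [algebraMap_eq]
      rw [Polynomial.aeval_def, Polynomial.hom_eval₂, hid, eval_X, Polynomial.eval₂_id]
    rwa [h2] at h1

open scoped Fin.CommRing in
/-- A cyclically indexed sequence with `x (j + 1) = x j ^ d` consists of fixed points of the
`M`-th iterate of `x ↦ x ^ d`. -/
theorem pow_pow_eq_self_of_cyclic {A : Type*} [Monoid A] {M d : ℕ} (x : Fin (M + 1) → A)
    (h : ∀ j, x (j + 1) = x j ^ d) (j : Fin (M + 1)) : x j ^ d ^ (M + 1) = x j := by
  have : ∀ i : ℕ, x (j + (i : Fin (M + 1))) = x j ^ d ^ i := by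
    intro i
    induction i with
    | zero => simp
    | succ i ih => rw [Nat.cast_succ, ← add_assoc, h, ih, ← pow_mul, pow_succ]
  rw [← this (M + 1)]
  simp

-- The zero at index `1` propagates once around the cycle, index `0` included.
open scoped Fin.CommRing in
theorem eq_zero_of_cyclic {A : Type*} [Zero A] {M : ℕ} (x : Fin (M + 1) → A)
    (h1 : x 1 = 0) (h : ∀ j, x j = 0 → x (j + 1) = 0) (j : Fin (M + 1)) : x j = 0 := by
  have : ∀ i : ℕ, x ((i : Fin (M + 1)) + 1) = 0 := by
    intro i
    induction i with
    | zero => simpa using h1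
    | succ i ih =>
      rw [Nat.cast_succ]
      exact h _ ih
  have hj := this (j.val + M)
  have hcast : (((j.val + M : ℕ) : Fin (M + 1)) + 1) = j := by
    rw [← Nat.cast_succ, show (j.val + M).succ = j.val + (M + 1) by omega, Nat.cast_add]
    simp
  rwa [hcast] at hj

/-- The space of unknowns: the points of a cycle of length `M + 1` in affine `(m + 2)`-space, and
the two parameters. -/
abbrev CycleIndex (m M : ℕ) : Type := (Fin (M + 1) × Fin (m + 2)) ⊕ Bool

/-- The universal member of the two-parameter family. -/
noncomputable def universalCoeffs {m e : ℕ} (M : ℕ) (c₁ : CoeffIndex (m + 1) (e + 2) → k) :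
    CoeffIndex (m + 1) (e + 2) → MvPolynomial (CycleIndex m M) k :=
  familyCoeffs e C c₁ (X (Sum.inr false)) (X (Sum.inr true))

/-- The equations of a cycle whose first point is critical. -/
noncomputable def cycleEquation {m e : ℕ} (M : ℕ) (c₁ : CoeffIndex (m + 1) (e + 2) → k) :
    (Fin (M + 1) × Fin (m + 2)) ⊕ Unit → MvPolynomial (CycleIndex m M) k
  | .inl (j, i) => eval (fun l => X (Sum.inl (j, l))) (genForm (universalCoeffs M c₁) i) -
      X (Sum.inl (j + 1, i))
  | .inr _ => eval (fun l => X (Sum.inl (0, l))) (genJacobian (universalCoeffs M c₁))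

theorem map_eval_eq {A B σ : Type*} [CommSemiring A] [CommSemiring B] (ψ : A →+* B) (x : σ → A)
    (f : MvPolynomial σ A) : ψ (eval x f) = eval (fun i => ψ (x i)) (map ψ f) := by
  induction f using MvPolynomial.induction_on <;> simp_all

theorem map_cycleEquation_inl {A : Type*} [CommRing A] {m e M : ℕ}
    (c₁ : CoeffIndex (m + 1) (e + 2) → k) (ψ : MvPolynomial (CycleIndex m M) k →+* A)
    (j : Fin (M + 1)) (i : Fin (m + 2)) : ψ (cycleEquation M c₁ (.inl (j, i))) =
      eval (fun l => ψ (X (.inl (j, l)))) (genForm (familyCoeffs e (ψ.comp C) c₁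
        (ψ (X (.inr false))) (ψ (X (.inr true)))) i) - ψ (X (.inl (j + 1, i))) := by
  simp only [cycleEquation, map_sub, map_eval_eq, map_genForm, universalCoeffs, map_familyCoeffs]

theorem map_cycleEquation_inr {A : Type*} [CommRing A] {m e M : ℕ}
    (c₁ : CoeffIndex (m + 1) (e + 2) → k) (ψ : MvPolynomial (CycleIndex m M) k →+* A) :
    ψ (cycleEquation M c₁ (.inr ())) =
      eval (fun l => ψ (X (.inl (0, l)))) (genJacobian (familyCoeffs e (ψ.comp C) c₁
        (ψ (X (.inr false))) (ψ (X (.inr true))))) := by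
  simp only [cycleEquation, map_eval_eq, map_genJacobian, universalCoeffs, map_familyCoeffs]

/-- The cycle of the special member with parameter `ζ`. -/
def specialCycle (m M d : ℕ) (ζ : k) : CycleIndex m M → k
  | .inl (j, i) => (Fin.cons 1 (Fin.cons (ζ ^ d ^ j.val) fun _ => 0) : Fin (m + 2) → k) i
  | .inr false => ζ
  | .inr true => 0

/-- Modulo `q` the map is a skew one. The coordinates `x₀`, `x₁` are then roots of the separable
polynomial `X ^ d ^ (M + 1) - X`, the critical equation forces `t = x₁`, and this makes the other
coordinates vanish after one step. -/
theorem cycle_isolated [CharZero k] {m e M : ℕ}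
    (c₁ : CoeffIndex (m + 1) (e + 2) → k) {ζ : k} (hζ : ζ ^ ((e + 2) ^ (M + 1) - 1) = 1)
    (q : Ideal (MvPolynomial (CycleIndex m M) k)) (hq : q.IsPrime)
    (hqz : q ≤ RingHom.ker (eval (specialCycle m M (e + 2) ζ)))
    (hE : ∀ j, cycleEquation M c₁ j ∈ q) (hs : X (Sum.inr true) ∈ q) (v : CycleIndex m M) :
    X v - C (specialCycle m M (e + 2) ζ v) ∈ q := by
  set z := specialCycle m M (e + 2) ζ with hz
  have hpow : 1 < (e + 2) ^ (M + 1) := Nat.one_lt_pow (Nat.succ_ne_zero _) (by omega)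
  have hζ0 : ζ ≠ 0 := by
    rintro rfl
    rw [zero_pow (by omega)] at hζ
    exact zero_ne_one hζ
  set π := Ideal.Quotient.mk q with hπ
  have hπ0 : ∀ f, π f = 0 ↔ f ∈ q := fun f => Ideal.Quotient.eq_zero_iff_mem
  have hne : ∀ f, eval z f ≠ 0 → π f ≠ 0 := fun f hf h => hf (hqz ((hπ0 f).1 h))
  have := (Ideal.Quotient.isDomain_iff_prime q).2 hq
  have hs0 : π (X (Sum.inr true)) = 0 := (hπ0 _).2 hs
  set x : Fin (M + 1) → Fin (m + 2) → MvPolynomial (CycleIndex m M) k ⧸ q :=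
    fun j i => π (X (.inl (j, i))) with hx
  set t := π (X (Sum.inr false)) with ht
  have hstep : ∀ j i, x (j + 1) i = eval (x j) (skewForm e t i) := by
    intro j i
    have h := (hπ0 _).2 (hE (.inl (j, i)))
    rw [map_cycleEquation_inl, hs0, genForm_familyCoeffs_zero, sub_eq_zero] at h
    exact h.symm
  have hcrit : eval (x 0) ((C ((e : MvPolynomial (CycleIndex m M) k ⧸ q) + 2) * X 0 ^ (e + 1)) *
      (C ((e : MvPolynomial (CycleIndex m M) k ⧸ q) + 2) * X 1 ^ (e + 1)) *
        ((X 1 - C t * X 0) * X 0 ^ e) ^ m) = 0 := by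
    have h := (hπ0 _).2 (hE (.inr ()))
    rw [map_cycleEquation_inr, hs0, genJacobian_familyCoeffs_zero] at h
    exact h
  have hroot : ∀ (j : Fin (M + 1)) (i : Fin (m + 2)), x j i ^ (e + 2) ^ (M + 1) = x j i →
      z (.inl (j, i)) ^ ((e + 2) ^ (M + 1) - 1) = 1 →
      X (.inl (j, i)) - C (z (.inl (j, i))) ∈ q := by
    intro j i h1 h2
    refine X_sub_C_mem_of_simple_root hq hqz _
      (Polynomial.X ^ (e + 2) ^ (M + 1) - Polynomial.X) ?_ ?_ ?_
    · obtain ⟨r, hr⟩ := Nat.exists_eq_add_of_lt hpow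
      have hr' : (e + 2) ^ (M + 1) - 1 = r + 1 := by omega
      have hr'' : (e + 2) ^ (M + 1) = (r + 1) + 1 := by omega
      rw [hr'] at h2
      rw [hr'', Polynomial.IsRoot, Polynomial.eval_sub, Polynomial.eval_pow, Polynomial.eval_X,
        pow_succ, h2, one_mul, sub_self]
    · rw [Polynomial.derivative_sub, Polynomial.derivative_X_pow, Polynomial.derivative_X,
        Polynomial.eval_sub, Polynomial.eval_mul, Polynomial.eval_pow, Polynomial.eval_X, h2,
        Polynomial.eval_C, Polynomial.eval_one, mul_one, sub_ne_zero]
      exact_mod_cast hpow.ne'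
    · rw [← hπ0]
      simp only [map_sub, map_pow, Polynomial.aeval_X]
      rw [sub_eq_zero]
      exact h1
  have h0 : ∀ j, X (.inl (j, 0)) - C (z (.inl (j, 0))) ∈ q := by
    intro j
    refine hroot j 0 (pow_pow_eq_self_of_cyclic (fun j => x j 0) (fun j => ?_) j) ?_
    · rw [hstep]
      simp [skewForm]
    · simp [hz, specialCycle]
  have h1 : ∀ j, X (.inl (j, 1)) - C (z (.inl (j, 1))) ∈ q := by
    intro j
    refine hroot j 1 (pow_pow_eq_self_of_cyclic (fun j => x j 1) (fun j => ?_) j) ?_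
    · rw [hstep]
      simp [skewForm]
    · simp only [hz, specialCycle, Fin.cons_one, Fin.cons_zero]
      rw [← pow_mul, mul_comm, pow_mul, hζ, one_pow]
  have hx0 : ∀ j, x j 0 = 1 := by
    intro j
    have h := (hπ0 _).2 (h0 j)
    rw [map_sub, sub_eq_zero] at h
    rw [hx]
    simpa [hz, specialCycle] using h
  have hx1 : x 0 1 = π (C ζ) := by
    have h := (hπ0 _).2 (h1 0)
    rw [map_sub, sub_eq_zero] at h
    rw [hx]
    simpa [hz, specialCycle] using h
  have hdne : ((e : MvPolynomial (CycleIndex m M) k ⧸ q) + 2) ≠ 0 := by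
    have h := hne (C ((e : k) + 2)) (by
      rw [eval_C]
      exact_mod_cast Nat.succ_ne_zero (e + 1))
    intro h'
    refine h ?_
    rw [map_add, map_natCast, map_ofNat, map_add, map_natCast, map_ofNat, h']
  have hx1ne : x 0 1 ≠ 0 := by
    rw [hx1]
    exact hne _ (by simpa using hζ0)
  -- Since `x₀ = 1` and `x₁ ≠ 0`, the only factor of the Jacobian determinant that can vanish is
  -- `(x₁ - t x₀) ^ m`.
  have htζ : x 0 1 = t := by
    simp only [map_mul, map_pow, map_sub, eval_C, eval_X, hx0, one_pow, mul_one] at hcrit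
    have h2 := (mul_eq_zero.1 hcrit).resolve_left
      (mul_ne_zero hdne (mul_ne_zero hdne (pow_ne_zero _ hx1ne)))
    exact sub_eq_zero.1 (eq_zero_of_pow_eq_zero h2)
  rcases v with ⟨j, i⟩ | b
  · refine Fin.cases (h0 j) (fun i => Fin.cases (h1 j) (fun i => ?_) i) i
    have hzero : x j i.succ.succ = 0 := by
      refine eq_zero_of_cyclic (fun j => x j i.succ.succ) ?_ (fun j hj => ?_) j
      · have := hstep 0 i.succ.succ
        rw [zero_add] at this
        simp only [this, skewForm, Fin.cons_succ, map_mul, map_sub, map_pow, eval_X, eval_C, hx0,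
          htζ]
        ring
      · have hj : x j i.succ.succ = 0 := hj
        simp [hstep, skewForm, hj]
    rw [← hπ0, map_sub, sub_eq_zero]
    refine Eq.trans hzero ?_
    simp [hz, specialCycle]
  · cases b
    · rw [← hπ0, map_sub, sub_eq_zero]
      exact htζ.symm.trans hx1
    · simpa [hz, specialCycle] using hs

theorem eval_cycleEquation_specialCycle {m e M : ℕ} (hm : m ≠ 0)
    (c₁ : CoeffIndex (m + 1) (e + 2) → k) {ζ : k} (hζ : ζ ^ ((e + 2) ^ (M + 1) - 1) = 1)
    (j : (Fin (M + 1) × Fin (m + 2)) ⊕ Unit) :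
    eval (specialCycle m M (e + 2) ζ) (cycleEquation M c₁ j) = 0 := by
  have hs : eval (specialCycle m M (e + 2) ζ) (X (Sum.inr true)) = 0 := by simp [specialCycle]
  have hpow : 1 < (e + 2) ^ (M + 1) := Nat.one_lt_pow (Nat.succ_ne_zero _) (by omega)
  rcases j with ⟨j, i⟩ | ⟨⟩
  · rw [map_cycleEquation_inl, hs, genForm_familyCoeffs_zero, sub_eq_zero]
    refine Fin.cases ?_ (fun i => Fin.cases ?_ (fun i => ?_) i) i
    · simp [skewForm, specialCycle]
    · simp only [skewForm, specialCycle, Fin.cons_succ, Fin.cons_zero, map_pow, eval_X,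
        Fin.cons_one]
      rw [← pow_mul, ← pow_succ]
      -- At the last index the cycle closes up because `ζ ^ d ^ (M + 1) = ζ`.
      by_cases hj : j = Fin.last M
      · subst hj
        obtain ⟨r, hr⟩ := Nat.exists_eq_add_of_lt hpow
        have hr' : (e + 2) ^ (M + 1) - 1 = r + 1 := by omega
        have hr'' : (e + 2) ^ (M + 1) = (r + 1) + 1 := by omega
        rw [hr'] at hζ
        simp [hr'', pow_succ (n := r + 1), hζ]
      · rw [Fin.val_add_one_of_lt (Fin.lt_last_iff_ne_last.2 hj)]
    · simp [skewForm, specialCycle]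
  · rw [map_cycleEquation_inr, hs, genJacobian_familyCoeffs_zero]
    simp [specialCycle, hm]

/-- A polynomial with fewer than `D` roots does not vanish at some `D`-th root of unity. -/
theorem exists_root_of_unity_eval_ne_zero [IsAlgClosed k] [CharZero k] {g : Polynomial k}
    (hg : g ≠ 0) {D : ℕ} (hD : g.natDegree < D) : ∃ ζ : k, ζ ^ D = 1 ∧ g.eval ζ ≠ 0 := by
  classical
  have hD0 : 0 < D := by omega
  have : NeZero (D : k) := ⟨Nat.cast_ne_zero.2 hD0.ne'⟩
  obtain ⟨ω, hω⟩ := HasEnoughRootsOfUnity.exists_primitiveRoot k D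
  by_contra! hcon
  have hsub : Polynomial.nthRootsFinset D (1 : k) ⊆ g.roots.toFinset := by
    intro ζ hζ
    rw [Polynomial.mem_nthRootsFinset hD0] at hζ
    rw [Multiset.mem_toFinset, Polynomial.mem_roots hg]
    exact hcon ζ hζ
  have h1 := Finset.card_le_card hsub
  rw [hω.card_nthRootsFinset] at h1
  have h2 := (Multiset.toFinset_card_le g.roots).trans (Polynomial.card_roots' g)
  omega

/-- **Density of periodic critical points.** A nonzero polynomial in the coefficients does not
vanish on the locus of tuples of forms having a periodic critical point in affine space. -/
theorem exists_periodic_critical_point [IsAlgClosed k] [CharZero k] {m e : ℕ} (hm : m ≠ 0)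
    {P : MvPolynomial (CoeffIndex (m + 1) (e + 2)) k} (hP : P ≠ 0) :
    ∃ c, eval c P ≠ 0 ∧ ∃ (M : ℕ) (x : Fin (M + 1) → Fin (m + 2) → k), x 0 ≠ 0 ∧
      (∀ j i, eval (x j) (genForm c i) = x (j + 1) i) ∧ eval (x 0) (genJacobian c) = 0 := by
  obtain ⟨c₁, hc₁⟩ : ∃ c₁, eval c₁ P ≠ 0 := by
    by_contra! h
    exact hP (MvPolynomial.funext fun c => by rw [h c, map_zero])
  -- The restriction of `P` to the family, with outer variable `s` and inner variable `t`.
  let Q : Polynomial (Polynomial k) := eval₂ (Polynomial.C.comp Polynomial.C)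
    (familyCoeffs e (Polynomial.C.comp Polynomial.C) c₁ (Polynomial.C Polynomial.X) Polynomial.X) P
  have hQeval : ∀ t s : k, Polynomial.evalEvalRingHom t s Q =
      eval (familyCoeffs e (RingHom.id k) c₁ t s) P := by
    intro t s
    have hid : (Polynomial.evalEvalRingHom t s).comp (Polynomial.C.comp Polynomial.C) =
        RingHom.id k := by
      ext a
      simp
    rw [hom_eval₂, hid]
    have hcoe : ⇑(Polynomial.evalEvalRingHom t s) ∘ familyCoeffs e
        (Polynomial.C.comp Polynomial.C) c₁ (Polynomial.C Polynomial.X) Polynomial.X =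
        familyCoeffs e (RingHom.id k) c₁ t s := by
      ext a
      rw [Function.comp_apply, map_familyCoeffs, hid]
      simp
    exact congrArg (fun c => eval c P) hcoe
  have hQ0 : Q ≠ 0 := by
    intro h
    have := hQeval 0 1
    rw [h, map_zero, familyCoeffs_zero_one _ rfl] at this
    exact hc₁ this.symm
  -- `P` may vanish on all skew tuples, so the largest power of `s` is divided out; the quotient `g`
  -- has `g(t, 0) ≠ 0`.
  obtain ⟨g, hQg, hg⟩ := Q.exists_eq_pow_rootMultiplicity_mul_and_not_dvd hQ0 0
  rw [map_zero, sub_zero, Polynomial.X_dvd_iff] at hg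
  rw [map_zero, sub_zero] at hQg
  set r := Q.rootMultiplicity 0
  -- Any `M` with `d ^ (M + 1) - 1 > deg g(t, 0)` would do, so that some root of unity `ζ` has `g(ζ,
  -- 0) ≠ 0`.
  set M := (g.coeff 0).natDegree with hM
  have hMlt : (g.coeff 0).natDegree < (e + 2) ^ (M + 1) - 1 := by
    have := Nat.lt_pow_self (n := M + 1) (show 1 < e + 2 by omega)
    omega
  obtain ⟨ζ, hζ, hgζ⟩ := exists_root_of_unity_eval_ne_zero hg hMlt
  let Ψ : Polynomial (Polynomial k) →+* MvPolynomial (CycleIndex m M) k :=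
    Polynomial.eval₂RingHom (Polynomial.eval₂RingHom C (X (.inr false))) (X (.inr true))
  have hΨ : ∀ (w : CycleIndex m M → k) (h : Polynomial (Polynomial k)),
      eval w (Ψ h) = Polynomial.evalEvalRingHom (w (.inr false)) (w (.inr true)) h := by
    intro w h
    have : (eval w).comp Ψ = Polynomial.evalEvalRingHom (w (.inr false)) (w (.inr true)) := by
      ext <;> simp [Ψ]
    exact DFunLike.congr_fun this h
  -- There are two parameters but only one equation beyond those of the cycle. The factor `X (.inl
  -- (0, 0))` keeps the first point of the cycle away from the origin.
  obtain ⟨w, hwE, hws, hwQ⟩ := exists_zero_of_isolated (by simp)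
    (cycleEquation M c₁) (X (.inr true)) (Ψ g * X (.inl (0, 0))) (specialCycle m M (e + 2) ζ)
    (eval_cycleEquation_specialCycle hm c₁ hζ) (by
      rw [map_mul, hΨ]
      simpa [specialCycle, Polynomial.evalEval, Polynomial.coeff_zero_eq_eval_zero] using hgζ)
    (cycle_isolated c₁ hζ)
  rw [map_mul, eval_X, hΨ] at hwQ
  rw [eval_X] at hws
  have hid : (eval w).comp C = RingHom.id k := by
    ext a
    simp
  refine ⟨familyCoeffs e (RingHom.id k) c₁ (w (.inr false)) (w (.inr true)), ?_, M,
    fun j i => w (.inl (j, i)), ?_, ?_, ?_⟩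
  · rw [← hQeval, hQg, map_mul, map_pow]
    refine mul_ne_zero (pow_ne_zero _ ?_) (left_ne_zero_of_mul hwQ)
    simpa [Polynomial.evalEval] using hws
  · intro h
    exact right_ne_zero_of_mul hwQ (congrFun h 0)
  · intro j i
    have h := hwE (.inl (j, i))
    rw [map_cycleEquation_inl, hid, sub_eq_zero] at h
    simpa using h
  · have h := hwE (.inr ())
    rw [map_cycleEquation_inr, hid] at h
    simpa using h

end PeriodicCriticalPoint

end DynImproper

namespace DynImproper

/-! ### Passage to projective space and conclusion -/

section Projective

variable {k : Type*} [Field k]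

theorem eval_smul_of_isHomogeneous {ι : Type*} {F : MvPolynomial ι k} {m : ℕ}
    (hF : F.IsHomogeneous m) (a : k) (v : ι → k) : eval (a • v) F = a ^ m * eval v F := by
  rw [eval_eq, eval_eq, Finset.mul_sum]
  refine Finset.sum_congr rfl fun d hd => ?_
  have hdeg := hF.degree_eq_sum_deg_support hd
  simp only [Pi.smul_apply, smul_eq_mul, mul_pow, Finset.prod_mul_distrib,
    Finset.prod_pow_eq_pow_sum]
  rw [hdeg]
  ring

theorem eval_rep_eq_zero_iff {ι : Type*} {F : MvPolynomial ι k} {m : ℕ}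
    (hF : F.IsHomogeneous m) (v : ι → k) (hv : v ≠ 0) :
    eval (Projectivization.mk k v hv).rep F = 0 ↔ eval v F = 0 := by
  obtain ⟨a, ha⟩ := Projectivization.exists_smul_eq_mk_rep k v hv
  rw [← ha, Units.smul_def, eval_smul_of_isHomogeneous hF, mul_eq_zero]
  exact or_iff_right (pow_ne_zero _ a.ne_zero)

/-- The hypersurface cut out by an irreducible form is irreducible. -/
theorem isIrreducible_zeroLocus [IsAlgClosed k] {ι : Type*} [Finite ι] {F : MvPolynomial ι k}
    {m : ℕ} (hF : F.IsHomogeneous m) (hirr : Irreducible F)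
    (hne : (zeroLocus {F}).Nonempty) : IsIrreducible (zeroLocus {F}) := by
  refine ⟨hne, ?_⟩
  rintro U V hU hV ⟨p, hpF, hpU⟩ ⟨q, hqF, hqV⟩
  obtain ⟨S, hS, hUS⟩ := (hU : ∃ S : Set (MvPolynomial ι k), IsHomogeneousSet S ∧ Uᶜ = zeroLocus S)
  obtain ⟨T, hT, hVT⟩ := (hV : ∃ T : Set (MvPolynomial ι k), IsHomogeneousSet T ∧ Vᶜ = zeroLocus T)
  have hp : p ∉ zeroLocus S := by
    rw [← hUS]
    exact fun h => h hpU
  have hq : q ∉ zeroLocus T := by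
    rw [← hVT]
    exact fun h => h hqV
  simp only [zeroLocus, Set.mem_ofPred_eq, not_forall] at hp hq
  obtain ⟨G, hGS, hGp⟩ := hp
  obtain ⟨H, hHT, hHq⟩ := hq
  obtain ⟨a, hGa⟩ := hS G hGS
  obtain ⟨b, hHb⟩ := hT H hHT
  obtain ⟨i, hi⟩ := Function.ne_iff.1 p.rep_nonzero
  by_contra hcon
  -- The factor `X i` takes care of the origin of the affine cone, where `G` or `H` could be nonzero
  -- constants; it does not vanish at `p`.
  have hvan : G * H * X i ∈ Ideal.span {F} := by
    have hprime : (Ideal.span {F}).IsPrime :=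
      (Ideal.span_singleton_prime hirr.ne_zero).2 hirr.prime
    rw [← IsPrime.vanishingIdeal_zeroLocus (K := k) (Ideal.span {F}), mem_vanishingIdeal_iff]
    intro v hv
    have hFv : eval v F = 0 := by
      have := hv F (Ideal.subset_span rfl)
      simpa [aeval_def] using this
    have goal : eval v (G * H * X i) = 0 := by
      by_cases hv0 : v = 0
      · simp [hv0]
      · have hmem : Projectivization.mk k v hv0 ∈ zeroLocus {F} := by
          rintro _ rfl
          exact (eval_rep_eq_zero_iff hF v hv0).2 hFv
        have hGH : eval v G = 0 ∨ eval v H = 0 := by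
          by_contra! hGH
          refine hcon ⟨Projectivization.mk k v hv0, hmem, ?_, ?_⟩
          · by_contra hU'
            have : Projectivization.mk k v hv0 ∈ Uᶜ := hU'
            rw [hUS] at this
            exact hGH.1 ((eval_rep_eq_zero_iff hGa v hv0).1 (this G hGS))
          · by_contra hV'
            have : Projectivization.mk k v hv0 ∈ Vᶜ := hV'
            rw [hVT] at this
            exact hGH.2 ((eval_rep_eq_zero_iff hHb v hv0).1 (this H hHT))
        rcases hGH with h | h <;> simp [h]
    simpa [aeval_def] using goal
  rw [Ideal.mem_span_singleton] at hvan
  have hdvd : ∀ (r : ℙ k (ι → k)) (K : MvPolynomial ι k), r ∈ zeroLocus {F} → F ∣ K →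
      eval r.rep K = 0 := by
    rintro r _ hr ⟨L, rfl⟩
    rw [map_mul, hr F rfl, zero_mul]
  rcases hirr.prime.dvd_or_dvd hvan with h | h
  · rcases hirr.prime.dvd_or_dvd h with h | h
    · exact hGp (hdvd p G hpF h)
    · exact hHq (hdvd q H hqF h)
  · refine hi ?_
    simpa using hdvd p _ hpF h

variable {n d : ℕ}

theorem genForm_smul (a : k) (c : CoeffIndex n d → k) (i : Fin (n + 1)) :
    genForm (a • c) i = C a * genForm c i := by
  simp [genForm, formOfCoeffs, Finset.mul_sum, C_mul_monomial]

theorem genJacobian_smul (a : k) (c : CoeffIndex n d → k) :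
    genJacobian (a • c) = C (a ^ (n + 1)) * genJacobian c := by
  have : (Matrix.of fun i j => pderiv j (genForm (a • c) i)) =
      (C a : MvPolynomial (Fin (n + 1)) k) • (Matrix.of fun i j => pderiv j (genForm c i)) := by
    ext1 i j
    simp [genForm_smul, Derivation.leibniz]
  rw [genJacobian, this, Matrix.det_smul, Fintype.card_fin, map_pow, genJacobian]

theorem toMap_mk (f : EndSpace k n d) (c : CoeffIndex n d → k) (a : kˣ) (hf : a • c = f.1.rep)
    (v w : Fin (n + 1) → k) (hv : v ≠ 0) (hw : w ≠ 0)
    (hvw : ∀ i, eval v (genForm c i) = w i) :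
    toMap f (Projectivization.mk k v hv) = Projectivization.mk k w hw := by
  obtain ⟨b, hb⟩ := Projectivization.exists_smul_eq_mk_rep k v hv
  rw [toMap, Projectivization.mk_eq_mk_iff']
  refine ⟨a * (b : k) ^ d, ?_⟩
  ext i
  have hform : form f.1.rep i = C (a : k) * genForm c i := by
    rw [← genForm_smul, ← Units.smul_def, hf]
    rfl
  rw [hform, ← hb, Units.smul_def, map_mul, eval_C,
    eval_smul_of_isHomogeneous (genForm_isHomogeneous c i), hvw, Pi.smul_apply, smul_eq_mul]
  ring

/-- A map with an irreducible set `H` containing a periodic point makes `H` dynamically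
improper. -/
theorem isDynamicallyImproper_of_periodic (g : PSpace k n → PSpace k n) {H : Set (PSpace k n)}
    (hH : IsIrreducible H) {p : PSpace k n} (hp : p ∈ H) {M : ℕ} (hM : M ≠ 0)
    (hper : g^[M] p = p) : IsDynamicallyImproper g H := by
  intro r hr W hW
  have := Subtype.irreducibleSpace hH
  rw [irreducibleComponents_eq_singleton, Set.mem_singleton_iff] at hW
  subst hW
  -- Taking multiples of `M` works for every `r` at once, since `g^[r]` iterated `j * M` times fixes
  -- `p`.
  refine ⟨fun j => j.val * M, fun i j hij => ?_, p, ?_⟩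
  · exact Nat.mul_lt_mul_of_pos_right hij (Nat.pos_of_ne_zero hM)
  · refine Set.mem_iInter.2 fun j => ⟨p, ⟨⟨p, hp⟩, Set.mem_univ _, rfl⟩, ?_⟩
    rw [← Function.iterate_mul, ← mul_assoc, mul_comm, Function.iterate_mul]
    exact Function.iterate_fixed hper _

-- The absence of common zeros keeps every vector of the affine cycle nonzero, so it descends to
-- projective space. The projective period may be a proper divisor of `M + 1`.
open scoped Fin.CommRing in
theorem iterate_toMap_mk (f : EndSpace k n d) (c : CoeffIndex n d → k) (a : kˣ)
    (hf : a • c = f.1.rep) (hc : ∀ v : Fin (n + 1) → k, v ≠ 0 → ∃ i, eval v (genForm c i) ≠ 0)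
    {M : ℕ} (x : Fin (M + 1) → Fin (n + 1) → k) (hx0 : x 0 ≠ 0)
    (hx : ∀ j i, eval (x j) (genForm c i) = x (j + 1) i) :
    (toMap f)^[M + 1] (Projectivization.mk k (x 0) hx0) = Projectivization.mk k (x 0) hx0 := by
  have key : ∀ i : ℕ, ∃ h : x (i : Fin (M + 1)) ≠ 0,
      (toMap f)^[i] (Projectivization.mk k (x 0) hx0) =
        Projectivization.mk k (x (i : Fin (M + 1))) h := by
    intro i
    induction i with
    | zero => exact ⟨by simpa using hx0, by simp⟩
    | succ i ih =>
      obtain ⟨h, hi⟩ := ih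
      have hne : x ((i + 1 : ℕ) : Fin (M + 1)) ≠ 0 := by
        obtain ⟨l, hl⟩ := hc _ h
        rw [hx] at hl
        intro h0
        rw [Nat.cast_succ] at h0
        exact hl (congrFun h0 l)
      refine ⟨hne, ?_⟩
      rw [Function.iterate_succ_apply', hi]
      refine toMap_mk f c a hf _ _ h hne fun l => ?_
      rw [hx, Nat.cast_succ]
  obtain ⟨h, hM⟩ := key (M + 1)
  rw [hM]
  congr 1
  simp

theorem map_eval_genForm_X (c : CoeffIndex n d → k)
    (i : Fin (n + 1)) : map (eval c) (genForm (X : CoeffIndex n d → _) i) = genForm c i := by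
  simp [map_genForm]

theorem map_eval_genJacobian_X (c : CoeffIndex n d → k) :
    map (eval c) (genJacobian (X : CoeffIndex n d → _)) = genJacobian c := by
  simp [map_genJacobian]

/-- Some tuple of forms has an irreducible Jacobian determinant. -/
theorem exists_irreducible_genJacobian [CharZero k] {m e : ℕ} (hm : m ≠ 0) :
    ∃ c : CoeffIndex (m + 1) (e + 2) → k, Irreducible (genJacobian c) := by
  have hhom : ∀ i, (pencilMap k m (e + 1) i).IsHomogeneous (e + 2) :=
    pencilMap_isHomogeneous m (e + 1)
  refine ⟨coeffVector (e + 2) (pencilMap k m (e + 1)), ?_⟩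
  rw [genJacobian]
  simp only [genForm_coeffVector hhom]
  rw [det_pencilMap]
  refine (irreducible_isUnit_mul ?_).2 (pencilJacobian_irreducible hm (Nat.succ_ne_zero e))
  exact IsUnit.map C (Ne.isUnit (pow_ne_zero _ (Nat.cast_add_one_ne_zero _)))

theorem dense_postCriticallyDynamicallyImproper [IsAlgClosed k] [CharZero k] {m e : ℕ}
    (hm : m ≠ 0) :
    Dense {f : EndSpace k (m + 1) (e + 2) | IsPostCriticallyDynamicallyImproper f} := by
  rw [dense_iff_inter_open]
  rintro _ ⟨V, hV, rfl⟩ ⟨f₀, hf₀⟩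
  obtain ⟨S, hS, hVS⟩ := (hV : ∃ S : Set (MvPolynomial (CoeffIndex (m + 1) (e + 2)) k),
    IsHomogeneousSet S ∧ Vᶜ = zeroLocus S)
  have hf₀S : f₀.1 ∉ zeroLocus S := by
    rw [← hVS]
    exact fun h => h hf₀
  simp only [zeroLocus, Set.mem_ofPred_eq, not_forall] at hf₀S
  obtain ⟨F, hFS, hF⟩ := hf₀S
  obtain ⟨a, hFa⟩ := hS F hFS
  obtain ⟨P, hP₀, hP⟩ := exists_forall_eval_ne_zero_of_no_common_zero
    (genForm (X : CoeffIndex (m + 1) (e + 2) → MvPolynomial (CoeffIndex (m + 1) (e + 2)) k))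
    (fun _ => e + 2) (genForm_isHomogeneous _) f₀.1.rep (by
      intro v hv
      obtain ⟨i, hi⟩ := f₀.2 v hv
      refine ⟨i, ?_⟩
      rw [map_eval_genForm_X]
      exact hi)
  obtain ⟨c₀, hc₀⟩ := exists_irreducible_genJacobian (k := k) (e := e) hm
  obtain ⟨Q, hQ₀, hQ⟩ := exists_forall_irreducible (D := (m + 1 + 1) * (e + 2 - 1))
    (mul_ne_zero (Nat.succ_ne_zero _) (by omega))
    (genJacobian (X : CoeffIndex (m + 1) (e + 2) → MvPolynomial (CoeffIndex (m + 1) (e + 2)) k))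
    (genJacobian_isHomogeneous _) c₀ (by rwa [map_eval_genJacobian_X])
  -- Nonvanishing of `F`, `P` and `Q` means, respectively, lying in the given open set, being a
  -- morphism, and having irreducible Jacobian determinant. Each is nonzero at some point, possibly
  -- not the same one.
  have hne : F * P * Q ≠ 0 := by
    refine mul_ne_zero (mul_ne_zero ?_ ?_) ?_ <;> rintro rfl
    · exact hF (map_zero _)
    · exact hP₀ (map_zero _)
    · exact hQ₀ (map_zero _)
  obtain ⟨c, hc, M, x, hx0, hx, hxJ⟩ := exists_periodic_critical_point hm hne
  rw [map_mul, map_mul] at hc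
  have hcQ := right_ne_zero_of_mul hc
  have hcP := right_ne_zero_of_mul (left_ne_zero_of_mul hc)
  have hcF := left_ne_zero_of_mul (left_ne_zero_of_mul hc)
  have hmor : ∀ v : Fin (m + 1 + 1) → k, v ≠ 0 → ∃ i, eval v (genForm c i) ≠ 0 := by
    intro v hv
    obtain ⟨i, hi⟩ := hP c hcP v hv
    rw [map_eval_genForm_X] at hi
    exact ⟨i, hi⟩
  have hirr : Irreducible (genJacobian c) := by
    have := hQ c hcQ
    rwa [map_eval_genJacobian_X] at this
  have hc0 : c ≠ 0 := by
    rintro rfl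
    obtain ⟨i, hi⟩ := hmor _ hx0
    have := genForm_smul (0 : k) (0 : CoeffIndex (m + 1) (e + 2) → k) i
    rw [zero_smul, map_zero, zero_mul] at this
    rw [this] at hi
    exact hi (map_zero _)
  obtain ⟨b, hb⟩ := Projectivization.exists_smul_eq_mk_rep k c hc0
  have hform : ∀ i, form (Projectivization.mk k c hc0).rep i = C (b : k) * genForm c i := by
    intro i
    rw [← genForm_smul, ← Units.smul_def, hb]
    rfl
  have hjac : jacobian (Projectivization.mk k c hc0).rep =
      C ((b : k) ^ (m + 1 + 1)) * genJacobian c := by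
    rw [← genJacobian_smul, ← Units.smul_def, hb]
    rfl
  have hf : IsMorphism (Projectivization.mk k c hc0) := by
    intro v hv
    obtain ⟨i, hi⟩ := hmor v hv
    refine ⟨i, ?_⟩
    rw [hform, map_mul, eval_C]
    exact mul_ne_zero b.ne_zero hi
  have hJhom : (jacobian (Projectivization.mk k c hc0).rep).IsHomogeneous
      ((m + 1 + 1) * (e + 2 - 1)) := genJacobian_isHomogeneous _
  have hJirr : Irreducible (jacobian (Projectivization.mk k c hc0).rep) := by
    rw [hjac]
    exact (irreducible_isUnit_mul (IsUnit.map C (b.isUnit.pow _))).2 hirr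
  have hp : Projectivization.mk k (x 0) hx0 ∈
      criticalLocus (⟨Projectivization.mk k c hc0, hf⟩ : EndSpace k (m + 1) (e + 2)) := by
    rintro _ rfl
    rw [eval_rep_eq_zero_iff hJhom, hjac, map_mul, hxJ, mul_zero]
  refine ⟨⟨Projectivization.mk k c hc0, hf⟩, ?_, ?_⟩
  · by_contra hcon
    have : Projectivization.mk k c hc0 ∈ Vᶜ := hcon
    rw [hVS] at this
    exact hcF ((eval_rep_eq_zero_iff hFa c hc0).1 (this F hFS))
  · exact isDynamicallyImproper_of_periodic _ (isIrreducible_zeroLocus hJhom hJirr ⟨_, hp⟩) hp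
      (Nat.succ_ne_zero M) (iterate_toMap_mk _ c b hb hmor x hx0 hx)

end Projective

end DynImproper

theorem theorem2 {k : Type*} [Field k] [IsAlgClosed k] [CharZero k] (n d : ℕ) (hn : 2 ≤ n)
    (hd : min n 3 ≤ d) :
    Dense {f : DynImproper.EndSpace k n d |
      DynImproper.IsPostCriticallyDynamicallyImproper f} := by
  obtain ⟨m, rfl⟩ : ∃ m, n = m + 1 := ⟨n - 1, by omega⟩
  -- Both `n` and `3` are at least `2`, hence so is `d`.
  obtain ⟨e, rfl⟩ : ∃ e, d = e + 2 := ⟨d - 2, by omega⟩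
  exact DynImproper.dense_postCriticallyDynamicallyImproper (by omega)
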